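/- Let $\mathbb D$ be the open unit disc of $\mathbb C$ and $dA$ the normalized area measure on it. A radial weight is a positive integrable function $\omega$ on $[0,1)$, extended to $\mathbb D$ by $\omega(z)=\omega(|z|)$; it is called regular if there are constants $0<c\le C<\infty$ such that $$c\le\frac{\int_r^1\omega(t)\,dt}{(1-r)\,\omega(r)}\le C\qquad\text{for all } r\in[0,1).$$ For $0<p<\infty$, the weighted Bergman space $A^p_\omega$ consists of all analytic functions $f$ on $\mathbb D$ with $\|f\|_{A^p_\omega}=\left(\int_{\mathbb D}|f|^p\,\omega\,dA\right)^{1/p}<\infty$. For a positive Borel measure $\mu$ on $\mathbb D$ and $0<s<\infty$, write $\|f\|_{L^s_\mu}=\left(\int_{\mathbb D}|f|^s\,d\mu\right)^{1/s}$; $\mu$ is called an $s$-Carleson measure for $A^p_\omega$ if the identity operator $I_d:A^p_\omega\to L^s_\mu$ is bounded, and $\|I_d\|_{A^p_\omega\to L^s_\mu}=\sup_{0\ne f\in A^p_\omega}\|f\|_{L^s_\mu}/\|f\|_{A^p_\omega}\in[0,\infty]$. **Theorem 2.** Let $n\ge1$, let $0<p_i,q_i<\infty$ and let $\omega_i$ be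 regular weights, $i=1,\dots,n$. Put $$\lambda=\sum_{i=1}^n\frac{q_i}{p_i},\qquad \omega(z)=\prod_{i=1}^n\omega_i(z)^{\frac{q_i}{\lambda p_i}},$$ and, for a positive Borel measure $\mu$ on $\mathbb D$, $$M_n(\mu)=\sup_{0\ne f_i\in A^{p_i}_{\omega_i},\ i=1,\dots,n}\ \frac{\int_{\mathbb D}\prod_{i=1}^n|f_i(z)|^{q_i}\,d\mu(z)}{\prod_{i=1}^n\|f_i\|_{A^{p_i}_{\omega_i}}^{q_i}}\in[0,\infty].$$ Then, for every positive Borel measure $\mu$ on $\mathbb D$, $\mu$ is a $\lambda$-Carleson measure for $A^1_\omega$ if and only if $M_n(\mu)<\infty$. Moreover, there is a constant $0<C<\infty$, depending only on $n$ and the $p_i,q_i,\omega_i$ (and not on $\mu$), such that for every positive Borel measure $\mu$ on $\mathbb D$ $$C^{-1}\,\|I_d\|_{A^{1/\lambda}_\omega\to L^1_\mu}\le M_n(\mu)\le C\,\|I_d\|_{A^{1/\lambda}_\omega\to L^1_\mu}.$$ -/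

import Mathlib

open MeasureTheory
open scoped ENNReal NNReal

noncomputable section

namespace WeightedBergman

/-- The open unit disc of the complex plane. -/
def disc : Set ℂ := Metric.ball 0 1

/-- The normalized area measure `dA` on the unit disc. -/
def areaMeasure : Measure ℂ := ENNReal.ofReal (Real.pi)⁻¹ • volume.restrict disc

/-- The tail integral `∫_r^1 ω(t) dt`. -/
def tail (ω : ℝ → ℝ) (r : ℝ) : ℝ := ∫ t in r..1, ω t

/-- A radial weight is given by its profile on `[0,1)`, a positive integrable function; the weight
itself is `z ↦ ω ‖z‖` on the disc. Values of the profile outside `[0,1)` play no role.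
(Lebesgue measurability is part of `IntegrableOn`.) -/
structure IsRadialWeight (ω : ℝ → ℝ) : Prop where
  pos : ∀ r ∈ Set.Ico (0 : ℝ) 1, 0 < ω r
  integrable : IntegrableOn ω (Set.Ico (0 : ℝ) 1) volume

/-- Regular weights: `tail ω r / ((1 - r) ω r)` is bounded above and below by positive constants
on `[0,1)`. -/
structure IsRegularWeight (ω : ℝ → ℝ) : Prop extends IsRadialWeight ω where
  comparable : ∃ c C : ℝ, 0 < c ∧ ∀ r ∈ Set.Ico (0 : ℝ) 1,
    c ≤ tail ω r / ((1 - r) * ω r) ∧ tail ω r / ((1 - r) * ω r) ≤ C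

/-- The measure `ω dA` on the unit disc. -/
def weightMeasure (ω : ℝ → ℝ) : Measure ℂ :=
  areaMeasure.withDensity fun z => ENNReal.ofReal (ω ‖z‖)

/-- The `L^p_μ` (quasi-)norm on the disc, `(∫_𝔻 |f|^p dμ)^{1/p}`, for `0 < p < ∞`. -/
def lpNorm (p : ℝ) (μ : Measure ℂ) (f : ℂ → ℂ) : ℝ≥0∞ :=
  eLpNorm f (ENNReal.ofReal p) (μ.restrict disc)

/-- The (quasi-)norm of the weighted Bergman space `A^p_ω`. -/
def bergmanNorm (p : ℝ) (ω : ℝ → ℝ) (f : ℂ → ℂ) : ℝ≥0∞ := lpNorm p (weightMeasure ω) f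

/-- The weighted Bergman space `A^p_ω`: functions analytic in the disc with finite norm. -/
def bergmanSpace (p : ℝ) (ω : ℝ → ℝ) : Set (ℂ → ℂ) :=
  {f | DifferentiableOn ℂ f disc ∧ bergmanNorm p ω f < ∞}

/-- `μ` is a `q`-Carleson measure for `A^p_ω`: the identity `A^p_ω → L^q_μ` is bounded. -/
def IsCarleson (q : ℝ) (p : ℝ) (ω : ℝ → ℝ) (μ : Measure ℂ) : Prop :=
  ∃ C : ℝ≥0, ∀ f ∈ bergmanSpace p ω, lpNorm q μ f ≤ C * bergmanNorm p ω f

/-- The operator norm of the identity `A^p_ω → L^q_μ`, with value `∞` if it is unbounded.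
For `f = 0` the quotient is `0 / 0 = 0`. -/
def idNorm (p : ℝ) (ω : ℝ → ℝ) (q : ℝ) (μ : Measure ℂ) : ℝ≥0∞ :=
  ⨆ f ∈ bergmanSpace p ω, lpNorm q μ f / bergmanNorm p ω f

/-- The supremum of `∫_𝔻 ∏ |f_i|^{q_i} dμ / ∏ ‖f_i‖^{q_i}` over `f_i ∈ A^{p_i}_{ω_i}`.
If some `f_i` vanishes identically, the quotient is `0 / 0 = 0`. -/
def multiNorm {n : ℕ} (p q : Fin n → ℝ) (ω : Fin n → ℝ → ℝ) (μ : Measure ℂ) : ℝ≥0∞ :=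
  ⨆ (f : Fin n → ℂ → ℂ) (_ : ∀ i, f i ∈ bergmanSpace (p i) (ω i)),
    (∫⁻ z in disc, ∏ i, ‖f i z‖ₑ ^ q i ∂μ) / ∏ i, bergmanNorm (p i) (ω i) (f i) ^ q i

/-- The exponent `λ = ∑ q_i / p_i`. -/
def totalExponent {n : ℕ} (p q : Fin n → ℝ) : ℝ := ∑ i, q i / p i

/-- The weight `ω = ∏ ω_i ^ (q_i / (λ p_i))`. -/
def productWeight {n : ℕ} (p q : Fin n → ℝ) (ω : Fin n → ℝ → ℝ) (r : ℝ) : ℝ :=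
  ∏ i, ω i r ^ (q i / (totalExponent p q * p i))

end WeightedBergman

end


noncomputable section

namespace WeightedBergman

open Set Metric Filter Topology

theorem lintegral_eq_lintegral_circleMap (c : ℂ) {g : ℂ → ℝ≥0∞} (hg : Measurable g) :
    ∫⁻ z, g z = ∫⁻ r in Ioi (0 : ℝ), ENNReal.ofReal r *
      ∫⁻ θ in Ioo (-Real.pi) Real.pi, g (circleMap c r θ) := by
  have : Measurable fun x : ℝ × ℝ => g (circleMap c x.1 x.2) :=
    hg.comp (by unfold circleMap; fun_prop)
  have hcoord (x : ℝ × ℝ) : c + Complex.polarCoord.symm x = circleMap c x.1 x.2 := by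
    simp [circleMap, Complex.exp_mul_I]
  rw [← lintegral_add_left_eq_self g c, ← Complex.lintegral_comp_polarCoord_symm,
    polarCoord_target, Measure.volume_eq_prod, ← Measure.prod_restrict]
  simp only [hcoord, smul_eq_mul]
  rw [lintegral_prod _ (by fun_prop)]
  exact lintegral_congr fun r =>
    lintegral_const_mul (ENNReal.ofReal r) (hg.comp (continuous_circleMap c r).measurable)

theorem lintegral_ball_eq_lintegral_circleMap (c : ℂ) (R : ℝ) {g : ℂ → ℝ≥0∞}
    (hg : Measurable ((ball c R).indicator g)) :
    ∫⁻ z in ball c R, g z = ∫⁻ r in Ioo (0 : ℝ) R, ENNReal.ofReal r *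
      ∫⁻ θ in Ioo (-Real.pi) Real.pi, g (circleMap c r θ) := by
  have hIoo : Ioo (0 : ℝ) R = Iio R ∩ Ioi 0 := by rw [inter_comm, Ioi_inter_Iio]
  rw [← lintegral_indicator measurableSet_ball, lintegral_eq_lintegral_circleMap c hg, hIoo,
    ← setLIntegral_indicator measurableSet_Iio]
  refine setLIntegral_congr_fun measurableSet_Ioi fun r (hr : 0 < r) => ?_
  have hmem (θ : ℝ) : circleMap c r θ ∈ ball c R ↔ r ∈ Iio R := by
    rw [mem_ball, dist_eq_norm, circleMap_sub_center, norm_circleMap_zero, abs_of_pos hr, mem_Iio]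
  by_cases h : r ∈ Iio R <;> simp [indicator, hmem, h]

theorem log_norm_le_circleAverage {f : ℂ → ℂ} {c : ℂ} {r : ℝ} (hr : 0 < r)
    (hf : AnalyticOnNhd ℂ f (closedBall c r)) (hc : f c ≠ 0) :
    Real.log ‖f c‖ ≤ Real.circleAverage (fun z => Real.log ‖f z‖) c r := by
  rw [← abs_of_pos hr] at hf
  rw [hf.circleAverage_log_norm hr.ne' hc]
  refine le_add_of_nonneg_left (finsum_nonneg fun u => ?_)
  by_cases hu : u ∈ closedBall c |r|
  · refine mul_nonneg (mod_cast MeromorphicOn.AnalyticOnNhd.divisor_nonneg hf u) ?_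
    rw [mem_closedBall, dist_eq_norm', abs_of_pos hr] at hu
    rcases (norm_nonneg (c - u)).eq_or_lt with h | h
    · simp [← h]
    · exact Real.log_nonneg (by rwa [← div_eq_mul_inv, one_le_div h])
  · simp [Function.locallyFinsuppWithin.apply_eq_zero_of_notMem _ hu]

theorem ae_circleMap_ne_zero {f : ℂ → ℂ} {c : ℂ} {r : ℝ} (hr : 0 < r)
    (hf : AnalyticOnNhd ℂ f (closedBall c r)) (hc : f c ≠ 0) :
    ∀ᵐ θ ∂volume.restrict (uIoc 0 (2 * Real.pi)), f (circleMap c r θ) ≠ 0 := by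
  have hball : IsConnected (closedBall c r) :=
    (convex_closedBall c r).isConnected ⟨c, mem_closedBall_self hr.le⟩
  have hcod : {z | f z ≠ 0} ∈ codiscreteWithin (sphere c |r|) := by
    rw [abs_of_pos hr]
    exact codiscreteWithin_mono sphere_subset_closedBall
      (hf.preimage_zero_mem_codiscreteWithin hc (mem_closedBall_self hr.le) hball)
  exact ae_restrict_le_codiscreteWithin measurableSet_uIoc
    (codiscreteWithin_mono (subset_univ _) (circleMap_preimage_codiscrete hr.ne' hcod))

theorem norm_rpow_le_circleAverage {f : ℂ → ℂ} {c : ℂ} {r p : ℝ} (hr : 0 < r) (hp : 0 < p)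
    (hf : AnalyticOnNhd ℂ f (closedBall c r)) :
    ‖f c‖ ^ p ≤ Real.circleAverage (fun z => ‖f z‖ ^ p) c r := by
  by_cases hc : f c = 0
  · rw [hc, norm_zero, Real.zero_rpow hp.ne']
    exact Real.circleAverage_nonneg_of_nonneg fun z _ => by positivity
  have hexp : ∀ᵐ θ ∂volume.restrict (uIoc 0 (2 * Real.pi)),
      Real.exp (p * Real.log ‖f (circleMap c r θ)‖) = ‖f (circleMap c r θ)‖ ^ p := by
    filter_upwards [ae_circleMap_ne_zero hr hf hc] with θ hθ
    rw [Real.rpow_def_of_pos (norm_pos_iff.2 hθ), mul_comm]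
  have hcont : Continuous fun θ => ‖f (circleMap c r θ)‖ ^ p :=
    (hf.continuousOn.comp_continuous (continuous_circleMap c r)
      (circleMap_mem_closedBall c hr.le)).norm.rpow_const fun _ => Or.inr hp.le
  have hlog : CircleIntegrable (fun z => Real.log ‖f z‖) c r := by
    refine (hf.mono ?_).meromorphicOn.circleIntegrable_log_norm
    rw [abs_of_pos hr]
    exact sphere_subset_closedBall
  have : NeZero (volume (uIoc 0 (2 * Real.pi))) := ⟨by simp [Real.pi_pos.ne']⟩
  have : IsFiniteMeasure (volume.restrict (uIoc 0 (2 * Real.pi))) :=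
    ⟨by simp [ENNReal.mul_lt_top]⟩
  calc ‖f c‖ ^ p = Real.exp (p * Real.log ‖f c‖) := by
        rw [Real.rpow_def_of_pos (norm_pos_iff.2 hc), mul_comm]
    _ ≤ Real.exp (p * Real.circleAverage (fun z => Real.log ‖f z‖) c r) := by
        gcongr
        exact log_norm_le_circleAverage hr hf hc
    _ = Real.exp (⨍ θ in 0..(2 * Real.pi), p * Real.log ‖f (circleMap c r θ)‖) := by
        rw [← smul_eq_mul, ← Real.circleAverage_fun_smul, Real.circleAverage_eq_intervalAverage]
        rfl
    _ ≤ ⨍ θ in 0..(2 * Real.pi), Real.exp (p * Real.log ‖f (circleMap c r θ)‖) :=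
        convexOn_exp.map_average_le Real.continuousOn_exp isClosed_univ (by simp)
          ((intervalIntegrable_iff.1 hlog).const_mul p)
          ((integrable_congr hexp).2 hcont.integrableOn_uIoc)
    _ = Real.circleAverage (fun z => ‖f z‖ ^ p) c r := by
        rw [Real.circleAverage_eq_intervalAverage]
        exact average_congr hexp

theorem lintegral_circleMap_eq_circleAverage {g : ℂ → ℝ} {c : ℂ} {r : ℝ} (hr : 0 ≤ r)
    (hg : ContinuousOn g (sphere c r)) (hg0 : ∀ z ∈ sphere c r, 0 ≤ g z) :
    ∫⁻ θ in Ioo (-Real.pi) Real.pi, ENNReal.ofReal (g (circleMap c r θ)) =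
      ENNReal.ofReal (2 * Real.pi * Real.circleAverage g c r) := by
  have hcont : Continuous fun θ => g (circleMap c r θ) :=
    hg.comp_continuous (continuous_circleMap c r) (circleMap_mem_sphere c hr)
  rw [← ofReal_integral_eq_lintegral_ofReal
    (hcont.integrableOn_Icc.mono_set Ioo_subset_Icc_self)
    (Eventually.of_forall fun θ => hg0 _ (circleMap_mem_sphere c hr θ)),
    Real.circleAverage_eq_integral_add (-Real.pi),
    intervalIntegral.integral_comp_add_right (fun θ => g (circleMap c r θ)),
    smul_eq_mul, mul_inv_cancel_left₀ (by positivity),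
    intervalIntegral.integral_of_le (by linarith [Real.pi_pos]), integral_Ioc_eq_integral_Ioo]
  congr 4 <;> ring

theorem enorm_rpow_mul_volume_le_lintegral_ball {f : ℂ → ℂ} {c : ℂ} {R p : ℝ} (hp : 0 < p)
    (hf : DifferentiableOn ℂ f (ball c R)) :
    ‖f c‖ₑ ^ p * volume (ball c R) ≤ ∫⁻ z in ball c R, ‖f z‖ₑ ^ p := by
  classical
  have hm : Measurable ((ball c R).indicator fun z => ‖f z‖ₑ ^ p) := by
    rw [← piecewise_eq_indicator]
    have hcont : ContinuousOn (fun z => ‖f z‖ₑ ^ p) (ball c R) :=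
      ENNReal.continuous_rpow_const.comp_continuousOn hf.continuousOn.enorm
    exact hcont.measurable_piecewise continuousOn_const measurableSet_ball
  rw [← setLIntegral_const, lintegral_ball_eq_lintegral_circleMap c R hm,
    lintegral_ball_eq_lintegral_circleMap c R (measurable_const.indicator measurableSet_ball)]
  refine setLIntegral_mono' measurableSet_Ioo fun r hr => ?_
  have hsub : closedBall c r ⊆ ball c R := closedBall_subset_ball hr.2
  have hcont : ContinuousOn (fun z => ‖f z‖ ^ p) (sphere c r) :=
    (hf.continuousOn.mono (sphere_subset_closedBall.trans hsub)).norm.rpow_const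
      fun _ _ => Or.inr hp.le
  have hmean := norm_rpow_le_circleAverage hr.1 hp ((hf.analyticOnNhd isOpen_ball).mono hsub)
  have henorm (z : ℂ) : ‖f z‖ₑ ^ p = ENNReal.ofReal (‖f z‖ ^ p) := by
    rw [← ofReal_norm, ENNReal.ofReal_rpow_of_nonneg (norm_nonneg _) hp.le]
  simp only [henorm]
  rw [lintegral_circleMap_eq_circleAverage hr.1.le hcont fun _ _ => by positivity,
    setLIntegral_const, Real.volume_Ioo, sub_neg_eq_add, ← two_mul,
    ENNReal.ofReal_mul (p := 2 * Real.pi) (by positivity), mul_comm (ENNReal.ofReal (‖f c‖ ^ p))]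
  gcongr

/-- Normal weights in the sense of Shields and Williams: `(1 - r) v(r)` decreases at least as fast
as `(1 - r) ^ a` and at most as fast as `(1 - r) ^ b`. Unlike a regular weight, a normal weight is
controlled pointwise; every regular weight is comparable to a normal one. -/
structure IsNormalWeight (v : ℝ → ℝ) (a b : ℝ) : Prop where
  measurable : Measurable v
  pos : ∀ r ∈ Ico (0 : ℝ) 1, 0 < v r
  exponent_pos : 0 < a
  antitoneOn : AntitoneOn (fun r => (1 - r) ^ (1 - a) * v r) (Ico 0 1)
  monotoneOn : MonotoneOn (fun r => (1 - r) ^ (1 - b) * v r) (Ico 0 1)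

theorem le_mul_div_rpow_of_rpow_mul_le {c x y v w : ℝ} (hx : 0 < x) (hy : 0 < y)
    (h : x ^ (1 - c) * v ≤ y ^ (1 - c) * w) : v ≤ w * (x / y) ^ (c - 1) := by
  rw [← neg_sub 1 c, Real.rpow_neg (by positivity), Real.div_rpow hx.le hy.le, inv_div,
    ← mul_div_assoc, le_div_iff₀ (by positivity)]
  linarith

namespace IsNormalWeight

variable {v : ℝ → ℝ} {a b : ℝ}

theorem le_mul_rpow_add_rpow (h : IsNormalWeight v a b) {r s : ℝ} (hr : r ∈ Ico (0 : ℝ) 1)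
    (hs : s ∈ Ico (0 : ℝ) 1) :
    v r ≤ v s * (((1 - r) / (1 - s)) ^ (a - 1) + ((1 - r) / (1 - s)) ^ (b - 1)) := by
  have hr1 : 0 < 1 - r := sub_pos.2 hr.2
  have hs1 : 0 < 1 - s := sub_pos.2 hs.2
  have hvs := h.pos s hs
  rw [mul_add]
  rcases le_total s r with hsr | hrs
  · exact (le_mul_div_rpow_of_rpow_mul_le hr1 hs1 (h.antitoneOn hs hr hsr)).trans
      (le_add_of_nonneg_right (by positivity))
  · exact (le_mul_div_rpow_of_rpow_mul_le hr1 hs1 (h.monotoneOn hr hs hrs)).trans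
      (le_add_of_nonneg_left (by positivity))

theorem one_sub_rpow_mul (h : IsNormalWeight v a b) {e : ℝ} (he : 0 < a + e) :
    IsNormalWeight (fun r => (1 - r) ^ e * v r) (a + e) (b + e) := by
  have hpow (c : ℝ) {r : ℝ} (hr : r ∈ Ico (0 : ℝ) 1) :
      (1 - r) ^ (1 - c) * v r = (1 - r) ^ (1 - (c + e)) * ((1 - r) ^ e * v r) := by
    rw [← mul_assoc, ← Real.rpow_add (sub_pos.2 hr.2)]
    congr 2
    ring
  exact
    { measurable := (by fun_prop : Measurable fun r : ℝ => (1 - r) ^ e).mul h.measurable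
      pos := fun r hr => mul_pos (Real.rpow_pos_of_pos (sub_pos.2 hr.2) e) (h.pos r hr)
      exponent_pos := he
      antitoneOn := h.antitoneOn.congr fun r hr => hpow a hr
      monotoneOn := h.monotoneOn.congr fun r hr => hpow b hr }

theorem prod_rpow {ι : Type*} [Fintype ι] {v : ι → ℝ → ℝ} {a b θ : ι → ℝ}
    (h : ∀ i, IsNormalWeight (v i) (a i) (b i)) (hθ : ∀ i, 0 ≤ θ i) (hθ1 : ∑ i, θ i = 1) :
    IsNormalWeight (fun r => ∏ i, v i r ^ θ i) (∑ i, θ i * a i) (∑ i, θ i * b i) := by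
  have hprod (c : ι → ℝ) {r : ℝ} (hr : r ∈ Ico (0 : ℝ) 1) :
      ∏ i, ((1 - r) ^ (1 - c i) * v i r) ^ θ i =
        (1 - r) ^ (1 - ∑ i, θ i * c i) * ∏ i, v i r ^ θ i := by
    have hr1 : 0 < 1 - r := sub_pos.2 hr.2
    simp_rw [Real.mul_rpow (Real.rpow_nonneg hr1.le _) ((h _).pos r hr).le,
      ← Real.rpow_mul hr1.le, Finset.prod_mul_distrib]
    rw [← Real.rpow_sum_of_pos hr1]
    simp_rw [sub_mul, one_mul, Finset.sum_sub_distrib, hθ1, mul_comm]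
  have hnonneg (c : ι → ℝ) (i : ι) {r : ℝ} (hr : r ∈ Ico (0 : ℝ) 1) :
      0 ≤ (1 - r) ^ (1 - c i) * v i r :=
    mul_nonneg (Real.rpow_nonneg (sub_pos.2 hr.2).le _) ((h i).pos r hr).le
  refine ⟨?_, fun r hr => ?_, ?_, ?_, ?_⟩
  · exact Finset.measurable_fun_prod _ fun i _ => (h i).measurable.pow_const _
  · exact Finset.prod_pos fun i _ => Real.rpow_pos_of_pos ((h i).pos r hr) _
  · obtain ⟨i, -, hi⟩ := Finset.exists_ne_zero_of_sum_ne_zero (hθ1.trans_ne one_ne_zero)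
    exact Finset.sum_pos' (fun j _ => mul_nonneg (hθ j) (h j).exponent_pos.le)
      ⟨i, Finset.mem_univ i, mul_pos ((hθ i).lt_of_ne' hi) (h i).exponent_pos⟩
  · refine AntitoneOn.congr (fun r hr s hs hrs => ?_) fun r hr => hprod a hr
    exact Finset.prod_le_prod (fun i _ => Real.rpow_nonneg (hnonneg a i hs) _) fun i _ =>
      Real.rpow_le_rpow (hnonneg a i hs) ((h i).antitoneOn hr hs hrs) (hθ i)
  · refine MonotoneOn.congr (fun r hr s hs hrs => ?_) fun r hr => hprod b hr
    exact Finset.prod_le_prod (fun i _ => Real.rpow_nonneg (hnonneg b i hr) _) fun i _ =>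
      Real.rpow_le_rpow (hnonneg b i hr) ((h i).monotoneOn hr hs hrs) (hθ i)

end IsNormalWeight

theorem mem_disc {z : ℂ} : z ∈ disc ↔ ‖z‖ < 1 := mem_ball_zero_iff

theorem measurableSet_disc : MeasurableSet disc := measurableSet_ball

theorem norm_mem_Ico {z : ℂ} (hz : z ∈ disc) : ‖z‖ ∈ Ico (0 : ℝ) 1 := ⟨norm_nonneg z, mem_disc.1 hz⟩

/-- The Cauchy kernel of the disc with pole at the reflection of `a`, normalized to have modulus
comparable to `1` near `a`. -/
def kernel (a z : ℂ) : ℂ := (1 - ‖a‖ : ℝ) / (1 - (starRingEnd ℂ) a * z)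

theorem one_sub_mul_le_norm (a z : ℂ) : 1 - ‖a‖ * ‖z‖ ≤ ‖1 - (starRingEnd ℂ) a * z‖ := by
  simpa using norm_sub_norm_le (1 : ℂ) ((starRingEnd ℂ) a * z)

theorem one_sub_mul_norm_pos {a z : ℂ} (ha : a ∈ disc) (hz : z ∈ disc) : 0 < 1 - ‖a‖ * ‖z‖ := by
  have := mem_disc.1 ha
  have := mem_disc.1 hz
  nlinarith [norm_nonneg a, norm_nonneg z]

theorem one_sub_conj_mul_ne_zero {a z : ℂ} (ha : a ∈ disc) (hz : z ∈ disc) :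
    1 - (starRingEnd ℂ) a * z ≠ 0 :=
  norm_pos_iff.1 ((one_sub_mul_norm_pos ha hz).trans_le (one_sub_mul_le_norm a z))

theorem norm_kernel {a : ℂ} (ha : a ∈ disc) (z : ℂ) :
    ‖kernel a z‖ = (1 - ‖a‖) / ‖1 - (starRingEnd ℂ) a * z‖ := by
  rw [kernel, norm_div, Complex.norm_of_nonneg (sub_pos.2 (mem_disc.1 ha)).le]

@[fun_prop]
theorem measurable_kernel (a : ℂ) : Measurable (kernel a) := by
  unfold kernel
  fun_prop

theorem differentiableOn_kernel {a : ℂ} (ha : a ∈ disc) : DifferentiableOn ℂ (kernel a) disc := by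
  unfold kernel
  exact (differentiableOn_const _).div (by fun_prop) fun z hz => one_sub_conj_mul_ne_zero ha hz

theorem circleAverage_inv_norm_one_sub_sq {a : ℂ} {r : ℝ} (ha : a ∈ disc) (hr : 0 < r)
    (hr1 : r < 1) :
    Real.circleAverage (fun z => (‖1 - (starRingEnd ℂ) a * z‖ ^ 2)⁻¹) 0 r =
      (1 - (‖a‖ * r) ^ 2)⁻¹ := by
  have har : ‖a‖ * r < 1 := by nlinarith [mem_disc.1 ha, norm_nonneg a]
  have har2 : 1 - (‖a‖ * r) ^ 2 ≠ 0 := by nlinarith [mul_nonneg (norm_nonneg a) hr.le]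
  have hmem : (r : ℂ) ^ 2 * a ∈ ball (0 : ℂ) r := by
    rw [mem_ball_zero_iff, norm_mul, norm_pow, Complex.norm_of_nonneg hr.le]
    nlinarith
  -- The reflection of the pole of the kernel in the circle of radius `r` is `r ^ 2 * a`.
  have hpoisson (z : ℂ) (hz : z ∈ sphere 0 |r|) :
      (‖1 - (starRingEnd ℂ) a * z‖ ^ 2)⁻¹ =
        (1 - (‖a‖ * r) ^ 2)⁻¹ • poissonKernel 0 ((r : ℂ) ^ 2 * a) z := by
    rw [abs_of_pos hr, mem_sphere_zero_iff_norm] at hz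
    have hreflect : ‖z - (r : ℂ) ^ 2 * a‖ = r * ‖1 - (starRingEnd ℂ) a * z‖ := by
      rw [← RCLike.norm_conj (z - _)]
      calc _ = ‖(starRingEnd ℂ) z * (1 - (starRingEnd ℂ) a * z)‖ := by
            congr 1
            rw [← hz, mul_sub, mul_left_comm, Complex.conj_mul']
            simp
            ring
        _ = _ := by rw [norm_mul, RCLike.norm_conj, hz]
    rw [poissonKernel_def, sub_zero, sub_zero, hreflect, hz, norm_mul, norm_pow,
      Complex.norm_of_nonneg hr.le,
      show r ^ 2 - (r ^ 2 * ‖a‖) ^ 2 = r ^ 2 * (1 - (‖a‖ * r) ^ 2) by ring, mul_pow r ‖_‖,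
      mul_div_mul_left _ _ (pow_ne_zero 2 hr.ne'), div_eq_mul_inv, smul_eq_mul,
      inv_mul_cancel_left₀ har2]
  have hone : Real.circleAverage (poissonKernel 0 ((r : ℂ) ^ 2 * a)) 0 r = 1 := by
    have h := (InnerProductSpace.harmonicOnNhd_const (1 : ℝ)).circleAverage_poissonKernel_smul hmem
    rwa [show poissonKernel 0 ((r : ℂ) ^ 2 * a) • (fun _ => (1 : ℝ)) = poissonKernel 0 _ from
      mul_one _] at h
  rw [Real.circleAverage_congr_sphere hpoisson, Real.circleAverage_fun_smul, hone, smul_eq_mul,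
    mul_one]

theorem circleAverage_norm_kernel_rpow_le {a : ℂ} {r M : ℝ} (hM : 2 ≤ M) (ha : a ∈ disc)
    (hr : 0 < r) (hr1 : r < 1) :
    Real.circleAverage (fun z => ‖kernel a z‖ ^ M) 0 r ≤
      (1 - ‖a‖) ^ M * (1 - ‖a‖ * r) ^ (1 - M) := by
  have hsub : sphere (0 : ℂ) |r| ⊆ disc := by
    rw [abs_of_pos hr]
    exact sphere_subset_closedBall.trans (closedBall_subset_ball hr1)
  have har : 0 < 1 - ‖a‖ * r := by nlinarith [mem_disc.1 ha, norm_nonneg a]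
  have hcont : ContinuousOn (fun z => (‖1 - (starRingEnd ℂ) a * z‖ ^ 2)⁻¹) (sphere 0 |r|) :=
    ContinuousOn.inv₀ (by fun_prop) fun z hz =>
      pow_ne_zero 2 (norm_ne_zero_iff.2 (one_sub_conj_mul_ne_zero ha (hsub hz)))
  have hker : ContinuousOn (fun z => ‖kernel a z‖ ^ M) (sphere 0 |r|) :=
    ((differentiableOn_kernel ha).continuousOn.mono hsub).norm.rpow_const
      fun _ _ => Or.inr (by linarith)
  have ha1 : 0 < 1 - ‖a‖ := sub_pos.2 (mem_disc.1 ha)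
  calc Real.circleAverage (fun z => ‖kernel a z‖ ^ M) 0 r
      ≤ Real.circleAverage (fun z => ((1 - ‖a‖) ^ M * (1 - ‖a‖ * r) ^ (2 - M)) •
          (‖1 - (starRingEnd ℂ) a * z‖ ^ 2)⁻¹) 0 r := by
        refine Real.circleAverage_mono hker.circleIntegrable'
          (hcont.fun_const_smul _).circleIntegrable'
          fun z hz => ?_
        have hz' : ‖z‖ = r := by simpa [abs_of_pos hr] using hz
        have hle : 1 - ‖a‖ * r ≤ ‖1 - (starRingEnd ℂ) a * z‖ := hz' ▸ one_sub_mul_le_norm a z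
        have hx := har.trans_le hle
        have hpow := Real.rpow_le_rpow_of_nonpos har hle (by linarith : 2 - M ≤ 0)
        rw [norm_kernel ha, Real.div_rpow ha1.le hx.le, smul_eq_mul, mul_assoc, div_eq_mul_inv,
          ← Real.rpow_neg hx.le, ← Real.rpow_natCast, ← Real.rpow_neg hx.le]
        gcongr
        rw [show -M = 2 - M + -(2 : ℕ) by push_cast; ring, Real.rpow_add hx]
        gcongr
    _ = (1 - ‖a‖) ^ M * (1 - ‖a‖ * r) ^ (2 - M) * (1 - (‖a‖ * r) ^ 2)⁻¹ := by
        rw [Real.circleAverage_fun_smul, circleAverage_inv_norm_one_sub_sq ha hr hr1, smul_eq_mul]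
    _ ≤ (1 - ‖a‖) ^ M * (1 - ‖a‖ * r) ^ (2 - M) * (1 - ‖a‖ * r)⁻¹ := by
        gcongr
        nlinarith [mul_nonneg (norm_nonneg a) hr.le]
    _ = (1 - ‖a‖) ^ M * (1 - ‖a‖ * r) ^ (1 - M) := by
        rw [mul_assoc, ← Real.rpow_neg_one, ← Real.rpow_add har]
        ring_nf

theorem lintegral_Ioc_one_sub_rpow {e x y : ℝ} (hxy : x ≤ y) (hy : y ≤ 1)
    (hi : IntervalIntegrable (fun t : ℝ => t ^ e) volume (1 - y) (1 - x)) :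
    ∫⁻ r in Ioc x y, ENNReal.ofReal ((1 - r) ^ e) =
      ENNReal.ofReal (∫ t in (1 - y)..(1 - x), t ^ e) := by
  have hi' : IntervalIntegrable (fun r : ℝ => (1 - r) ^ e) volume x y := by
    simpa using (hi.comp_sub_left 1).symm
  rw [← intervalIntegral.integral_comp_sub_left (fun t : ℝ => t ^ e),
    intervalIntegral.integral_of_le hxy,
    ofReal_integral_eq_lintegral_ofReal ((intervalIntegrable_iff_integrableOn_Ioc_of_le hxy).1 hi')]
  refine (ae_restrict_iff' measurableSet_Ioc).2 (Eventually.of_forall fun r hr => ?_)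
  exact Real.rpow_nonneg (by linarith [hr.2]) _

theorem lintegral_one_sub_rpow_Ioc_one {e ρ : ℝ} (he : 0 < e + 1) (hρ : ρ ≤ 1) :
    ∫⁻ r in Ioc ρ 1, ENNReal.ofReal ((1 - r) ^ e) =
      ENNReal.ofReal ((1 - ρ) ^ (e + 1) / (e + 1)) := by
  rw [lintegral_Ioc_one_sub_rpow hρ le_rfl
    (intervalIntegral.intervalIntegrable_rpow' (by linarith)), sub_self,
    integral_rpow (Or.inl (by linarith)), Real.zero_rpow he.ne', sub_zero]

theorem lintegral_one_sub_rpow_Ioc_zero_le {e ρ : ℝ} (he : e + 1 < 0) (h0 : 0 ≤ ρ) (hρ : ρ < 1) :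
    ∫⁻ r in Ioc 0 ρ, ENNReal.ofReal ((1 - r) ^ e) ≤
      ENNReal.ofReal ((1 - ρ) ^ (e + 1) / -(e + 1)) := by
  have hnot : (0 : ℝ) ∉ uIcc (1 - ρ) (1 - 0) := by
    rw [uIcc_of_le (by linarith)]
    exact fun h => (sub_pos.2 hρ).not_ge h.1
  rw [lintegral_Ioc_one_sub_rpow h0 hρ.le (intervalIntegral.intervalIntegrable_rpow (Or.inr hnot)),
    integral_rpow (Or.inr ⟨by linarith, hnot⟩), sub_zero, Real.one_rpow, div_neg,
    ← neg_div]
  refine ENNReal.ofReal_le_ofReal ((div_le_div_right_of_neg he).2 ?_)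
  linarith

theorem lintegral_one_sub_rpow_mul_one_sub_mul_rpow_le {e M ρ : ℝ} (he : 0 < e + 1)
    (hM : e + 2 < M) (h0 : 0 ≤ ρ) (hρ : ρ < 1) :
    ∫⁻ r in Ioo 0 1, ENNReal.ofReal ((1 - r) ^ e * (1 - ρ * r) ^ (1 - M)) ≤
      ENNReal.ofReal ((1 / (M - (e + 2)) + 1 / (e + 1)) * (1 - ρ) ^ (e + 2 - M)) := by
  have hρ1 : 0 < 1 - ρ := sub_pos.2 hρ
  have hhead : ∫⁻ r in Ioc 0 ρ, ENNReal.ofReal ((1 - r) ^ e * (1 - ρ * r) ^ (1 - M)) ≤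
      ENNReal.ofReal (1 / (M - (e + 2)) * (1 - ρ) ^ (e + 2 - M)) := by
    calc _ ≤ ∫⁻ r in Ioc 0 ρ, ENNReal.ofReal ((1 - r) ^ (e + (1 - M))) := by
          refine setLIntegral_mono' measurableSet_Ioc fun r hr => ?_
          have hr1 : 0 < 1 - r := by linarith [hr.2]
          rw [Real.rpow_add hr1]
          gcongr ENNReal.ofReal (_ * ?_)
          exact Real.rpow_le_rpow_of_nonpos hr1 (by nlinarith [hr.1]) (by linarith)
      _ ≤ _ := by
          refine (lintegral_one_sub_rpow_Ioc_zero_le (by linarith) h0 hρ).trans_eq ?_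
          congr 1
          ring_nf
  have htail : ∫⁻ r in Ioc ρ 1, ENNReal.ofReal ((1 - r) ^ e * (1 - ρ * r) ^ (1 - M)) ≤
      ENNReal.ofReal (1 / (e + 1) * (1 - ρ) ^ (e + 2 - M)) := by
    calc _ ≤ ∫⁻ r in Ioc ρ 1,
            ENNReal.ofReal ((1 - ρ) ^ (1 - M)) * ENNReal.ofReal ((1 - r) ^ e) := by
          refine setLIntegral_mono' measurableSet_Ioc fun r hr => ?_
          have hr1 : 0 ≤ 1 - r := by linarith [hr.2]
          rw [← ENNReal.ofReal_mul (by positivity), mul_comm]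
          gcongr ENNReal.ofReal (?_ * _)
          exact Real.rpow_le_rpow_of_nonpos hρ1 (by nlinarith [hr.1]) (by linarith)
      _ = _ := by
          rw [lintegral_const_mul' _ _ ENNReal.ofReal_ne_top,
            lintegral_one_sub_rpow_Ioc_one he hρ.le, ← ENNReal.ofReal_mul (by positivity),
            show e + 2 - M = 1 - M + (e + 1) by ring, Real.rpow_add hρ1 (1 - M) (e + 1)]
          congr 1
          ring
  calc _ ≤ ∫⁻ r in Ioc 0 ρ ∪ Ioc ρ 1, ENNReal.ofReal ((1 - r) ^ e * (1 - ρ * r) ^ (1 - M)) :=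
        lintegral_mono_set (by
          rw [Ioc_union_Ioc_eq_Ioc h0 hρ.le]
          exact Ioo_subset_Ioc_self)
    _ ≤ _ := (lintegral_union_le _ _ _).trans (add_le_add hhead htail)
    _ = _ := by
        have : 0 < M - (e + 2) := sub_pos.2 hM
        rw [← ENNReal.ofReal_add (by positivity) (by positivity), add_mul]

theorem lintegral_circleMap_kernel_rpow_le {a : ℂ} {r M : ℝ} (hM : 2 ≤ M) (ha : a ∈ disc)
    (hr : r ∈ Ioo (0 : ℝ) 1) :
    ∫⁻ θ in Ioo (-Real.pi) Real.pi, ‖kernel a (circleMap 0 r θ)‖ₑ ^ M ≤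
      ENNReal.ofReal (2 * Real.pi * (1 - ‖a‖) ^ M) *
        ENNReal.ofReal ((1 - ‖a‖ * r) ^ (1 - M)) := by
  have ha1 : 0 < 1 - ‖a‖ := sub_pos.2 (mem_disc.1 ha)
  have hsub : sphere (0 : ℂ) r ⊆ disc :=
    sphere_subset_closedBall.trans (closedBall_subset_ball hr.2)
  have hcont : ContinuousOn (fun z => ‖kernel a z‖ ^ M) (sphere 0 r) :=
    ((differentiableOn_kernel ha).continuousOn.mono hsub).norm.rpow_const
      fun _ _ => Or.inr (by linarith)
  simp_rw [← ofReal_norm, ENNReal.ofReal_rpow_of_nonneg (norm_nonneg _) (by linarith : 0 ≤ M)]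
  rw [lintegral_circleMap_eq_circleAverage hr.1.le hcont fun _ _ => by positivity,
    ← ENNReal.ofReal_mul (by positivity), mul_assoc (2 * Real.pi) ((1 - ‖a‖) ^ M)]
  refine ENNReal.ofReal_le_ofReal (mul_le_mul_of_nonneg_left ?_ Real.two_pi_pos.le)
  exact circleAverage_norm_kernel_rpow_le hM ha hr.1 hr.2

theorem lintegral_one_sub_rpow_mul_kernel_rpow_le {a : ℂ} {e M : ℝ} (he : 0 < e + 1) (hM2 : 2 ≤ M)
    (hM : e + 2 < M) (ha : a ∈ disc) :
    ∫⁻ z in disc, ENNReal.ofReal ((1 - ‖z‖) ^ e) * ‖kernel a z‖ₑ ^ M ≤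
      ENNReal.ofReal (2 * Real.pi * (1 / (M - (e + 2)) + 1 / (e + 1)) * (1 - ‖a‖) ^ (e + 2)) := by
  have ha1 : 0 < 1 - ‖a‖ := sub_pos.2 (mem_disc.1 ha)
  have hangular (r : ℝ) (hr : r ∈ Ioo (0 : ℝ) 1) :
      ENNReal.ofReal r * ∫⁻ θ in Ioo (-Real.pi) Real.pi,
        ENNReal.ofReal ((1 - ‖circleMap 0 r θ‖) ^ e) * ‖kernel a (circleMap 0 r θ)‖ₑ ^ M ≤
      ENNReal.ofReal (2 * Real.pi * (1 - ‖a‖) ^ M) *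
        ENNReal.ofReal ((1 - r) ^ e * (1 - ‖a‖ * r) ^ (1 - M)) := by
    have hr1 : 0 < 1 - r := sub_pos.2 hr.2
    simp_rw [norm_circleMap_zero, abs_of_pos hr.1]
    rw [lintegral_const_mul' _ _ ENNReal.ofReal_ne_top]
    calc _ ≤ 1 * (ENNReal.ofReal ((1 - r) ^ e) * (ENNReal.ofReal (2 * Real.pi * (1 - ‖a‖) ^ M) *
            ENNReal.ofReal ((1 - ‖a‖ * r) ^ (1 - M)))) :=
          mul_le_mul' (ENNReal.ofReal_le_one.2 hr.2.le)
            (mul_le_mul_right (lintegral_circleMap_kernel_rpow_le hM2 ha hr) _)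
      _ = _ := by rw [one_mul, mul_left_comm, ← ENNReal.ofReal_mul (Real.rpow_nonneg hr1.le e)]
  have hmeas : Measurable
      ((ball 0 1).indicator fun z => ENNReal.ofReal ((1 - ‖z‖) ^ e) * ‖kernel a z‖ₑ ^ M) :=
    Measurable.indicator (by fun_prop) measurableSet_ball
  calc _ ≤ ∫⁻ r in Ioo 0 1, ENNReal.ofReal (2 * Real.pi * (1 - ‖a‖) ^ M) *
          ENNReal.ofReal ((1 - r) ^ e * (1 - ‖a‖ * r) ^ (1 - M)) :=
        (lintegral_ball_eq_lintegral_circleMap 0 1 hmeas).trans_le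
          (setLIntegral_mono' measurableSet_Ioo hangular)
    _ ≤ ENNReal.ofReal (2 * Real.pi * (1 - ‖a‖) ^ M) * ENNReal.ofReal
          ((1 / (M - (e + 2)) + 1 / (e + 1)) * (1 - ‖a‖) ^ (e + 2 - M)) := by
        rw [lintegral_const_mul' _ _ ENNReal.ofReal_ne_top]
        gcongr
        exact lintegral_one_sub_rpow_mul_one_sub_mul_rpow_le he hM (norm_nonneg a) (mem_disc.1 ha)
    _ = _ := by
        rw [← ENNReal.ofReal_mul (by positivity), Real.rpow_sub ha1]
        congr 1
        field_simp

theorem exists_lintegral_div_rpow_mul_kernel_rpow_le {e M : ℝ} (he : 0 < e) (hM2 : 2 ≤ M)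
    (hM : e + 1 < M) :
    ∃ C : ℝ≥0, ∀ a ∈ disc,
      ∫⁻ z in disc, ENNReal.ofReal (((1 - ‖z‖) / (1 - ‖a‖)) ^ (e - 1)) * ‖kernel a z‖ₑ ^ M ≤
        C * ENNReal.ofReal ((1 - ‖a‖) ^ 2) := by
  refine ⟨Real.toNNReal (2 * Real.pi * (1 / (M - (e - 1 + 2)) + 1 / (e - 1 + 1))), fun a ha => ?_⟩
  have ha1 : 0 < 1 - ‖a‖ := sub_pos.2 (mem_disc.1 ha)
  calc _ = ∫⁻ z in disc, ENNReal.ofReal ((1 - ‖a‖) ^ (1 - e)) *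
          (ENNReal.ofReal ((1 - ‖z‖) ^ (e - 1)) * ‖kernel a z‖ₑ ^ M) := by
        refine setLIntegral_congr_fun measurableSet_disc fun z hz => ?_
        have hz1 : 0 < 1 - ‖z‖ := sub_pos.2 (mem_disc.1 hz)
        rw [← mul_assoc, ← ENNReal.ofReal_mul (by positivity), Real.div_rpow hz1.le ha1.le,
          div_eq_inv_mul, ← Real.rpow_neg ha1.le, neg_sub]
    _ ≤ ENNReal.ofReal ((1 - ‖a‖) ^ (1 - e)) * ENNReal.ofReal
          (2 * Real.pi * (1 / (M - (e - 1 + 2)) + 1 / (e - 1 + 1)) * (1 - ‖a‖) ^ (e - 1 + 2)) := by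
        rw [lintegral_const_mul' _ _ ENNReal.ofReal_ne_top]
        gcongr
        exact lintegral_one_sub_rpow_mul_kernel_rpow_le (by linarith) hM2 (by linarith) ha
    _ = _ := by
        rw [← ENNReal.ofReal_mul (by positivity), mul_left_comm, ← Real.rpow_add ha1,
          ENNReal.ofReal_mul' (by positivity), ENNReal.ofReal, ← Real.rpow_natCast]
        congr 4
        push_cast
        ring

theorem lintegral_weightMeasure {v : ℝ → ℝ} (hv : Measurable v) (g : ℂ → ℝ≥0∞) :
    ∫⁻ z, g z ∂weightMeasure v =
      ENNReal.ofReal Real.pi⁻¹ * ∫⁻ z in disc, ENNReal.ofReal (v ‖z‖) * g z := by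
  rw [weightMeasure, lintegral_withDensity_eq_lintegral_mul_non_measurable _ (by fun_prop)
    (Eventually.of_forall fun _ => ENNReal.ofReal_lt_top), areaMeasure, lintegral_smul_measure]
  rfl

theorem setLIntegral_weightMeasure {v : ℝ → ℝ} (hv : Measurable v) {A : Set ℂ}
    (hA : MeasurableSet A) (hAd : A ⊆ disc) (g : ℂ → ℝ≥0∞) :
    ∫⁻ z in A, g z ∂weightMeasure v =
      ENNReal.ofReal Real.pi⁻¹ * ∫⁻ z in A, ENNReal.ofReal (v ‖z‖) * g z := by
  rw [← lintegral_indicator hA, lintegral_weightMeasure hv]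
  simp only [← indicator_mul_right A fun z : ℂ => ENNReal.ofReal (v ‖z‖)]
  rw [setLIntegral_indicator hA, inter_eq_left.2 hAd]

/-- The `weightMeasure v`-mass, up to constants, of a hyperbolic disc of fixed radius about `a`. -/
def cellWeight (v : ℝ → ℝ) (a : ℂ) : ℝ≥0∞ := ENNReal.ofReal ((1 - ‖a‖) ^ 2 * v ‖a‖)

theorem cellWeight_one_sub_rpow {a : ℂ} (ha : 0 < 1 - ‖a‖) (e : ℝ) :
    cellWeight (fun r => (1 - r) ^ e) a = ENNReal.ofReal ((1 - ‖a‖) ^ (e + 2)) := by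
  rw [cellWeight, Real.rpow_add ha, mul_comm, Real.rpow_two]

namespace IsNormalWeight

variable {v : ℝ → ℝ} {a b : ℝ}

theorem one_sub_rpow {e : ℝ} (he : 0 < e + 1) :
    IsNormalWeight (fun r => (1 - r) ^ e) (e + 1) (e + 1) := by
  have hconst : EqOn (fun _ => 1) (fun r : ℝ => (1 - r) ^ (1 - (e + 1)) * (1 - r) ^ e) (Ico 0 1) :=
    fun r hr => by
      beta_reduce
      rw [← Real.rpow_add (sub_pos.2 hr.2), sub_add_cancel_right, neg_add_cancel, Real.rpow_zero]
  exact
    { measurable := by fun_prop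
      pos := fun r hr => Real.rpow_pos_of_pos (sub_pos.2 hr.2) e
      exponent_pos := he
      antitoneOn := antitoneOn_const.congr hconst
      monotoneOn := monotoneOn_const.congr hconst }

theorem exponent_le (h : IsNormalWeight v a b) : a ≤ b := by
  have h0 : (0 : ℝ) ∈ Ico (0 : ℝ) 1 := by norm_num
  have h2 : (1 / 2 : ℝ) ∈ Ico (0 : ℝ) 1 := by norm_num
  have ha := h.antitoneOn h0 h2 h2.1
  have hb := h.monotoneOn h0 h2 h2.1
  simp only [sub_zero, Real.one_rpow, one_mul] at ha hb
  have := le_of_mul_le_mul_right (ha.trans hb) (h.pos _ h2)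
  rw [Real.rpow_le_rpow_left_iff_of_base_lt_one (by norm_num) (by norm_num)] at this
  linarith

theorem lintegral_kernel_rpow_le (h : IsNormalWeight v a b) {M : ℝ} (hM2 : 2 ≤ M)
    (hM : b + 1 < M) :
    ∃ C : ℝ≥0, ∀ c ∈ disc, ∫⁻ z, ‖kernel c z‖ₑ ^ M ∂weightMeasure v ≤ C * cellWeight v c := by
  have hab := h.exponent_le
  obtain ⟨A, hA⟩ := exists_lintegral_div_rpow_mul_kernel_rpow_le h.exponent_pos hM2 (by linarith)
  obtain ⟨B, hB⟩ :=
    exists_lintegral_div_rpow_mul_kernel_rpow_le (h.exponent_pos.trans_le hab) hM2 hM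
  refine ⟨Real.toNNReal Real.pi⁻¹ * (A + B), fun c hc => ?_⟩
  have hv := h.pos _ (norm_mem_Ico hc)
  have hc1 : 0 < 1 - ‖c‖ := sub_pos.2 (mem_disc.1 hc)
  have hgrowth : ∀ z ∈ disc, ENNReal.ofReal (v ‖z‖) * ‖kernel c z‖ₑ ^ M ≤
      ENNReal.ofReal (v ‖c‖) *
        (ENNReal.ofReal (((1 - ‖z‖) / (1 - ‖c‖)) ^ (a - 1)) * ‖kernel c z‖ₑ ^ M +
          ENNReal.ofReal (((1 - ‖z‖) / (1 - ‖c‖)) ^ (b - 1)) * ‖kernel c z‖ₑ ^ M) := by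
    intro z hz
    have hz1 : 0 < 1 - ‖z‖ := sub_pos.2 (mem_disc.1 hz)
    rw [← add_mul, ← mul_assoc, ← ENNReal.ofReal_add (by positivity) (by positivity),
      ← ENNReal.ofReal_mul hv.le]
    gcongr
    exact h.le_mul_rpow_add_rpow (norm_mem_Ico hz) (norm_mem_Ico hc)
  rw [lintegral_weightMeasure h.measurable, ENNReal.coe_mul, mul_assoc]
  refine mul_le_mul_right ?_ (ENNReal.ofReal Real.pi⁻¹)
  calc _ ≤ _ := setLIntegral_mono' measurableSet_disc hgrowth
    _ ≤ ENNReal.ofReal (v ‖c‖) * (A * ENNReal.ofReal ((1 - ‖c‖) ^ 2) +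
          B * ENNReal.ofReal ((1 - ‖c‖) ^ 2)) := by
        rw [lintegral_const_mul' _ _ ENNReal.ofReal_ne_top, lintegral_add_left (by fun_prop)]
        gcongr
        exacts [hA c hc, hB c hc]
    _ = _ := by
        rw [cellWeight, ENNReal.ofReal_mul (by positivity), ENNReal.coe_add]
        ring

end IsNormalWeight

theorem enorm_kernel_rpow_comm {a z : ℂ} (ha : a ∈ disc) (hz : z ∈ disc) (M : ℝ) :
    ‖kernel a z‖ₑ ^ M =
      ENNReal.ofReal ((1 - ‖a‖) ^ M) * ENNReal.ofReal ((1 - ‖z‖) ^ (-M)) * ‖kernel z a‖ₑ ^ M := by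
  have ha1 : 0 < 1 - ‖a‖ := sub_pos.2 (mem_disc.1 ha)
  have hz1 : 0 < 1 - ‖z‖ := sub_pos.2 (mem_disc.1 hz)
  have hconj : ‖1 - (starRingEnd ℂ) z * a‖ = ‖1 - (starRingEnd ℂ) a * z‖ := by
    rw [← RCLike.norm_conj (1 - (starRingEnd ℂ) z * a)]
    simp [mul_comm]
  have hpos := norm_pos_iff.2 (one_sub_conj_mul_ne_zero ha hz)
  have hkernel (c d : ℂ) (hc : c ∈ disc) (hd : d ∈ disc) :
      ‖kernel c d‖ₑ ^ M = ENNReal.ofReal (‖kernel c d‖ ^ M) := by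
    rw [← ofReal_norm, ENNReal.ofReal_rpow_of_pos (norm_kernel hc d ▸ div_pos
      (sub_pos.2 (mem_disc.1 hc)) (norm_pos_iff.2 (one_sub_conj_mul_ne_zero hc hd)))]
  rw [hkernel a z ha hz, hkernel z a hz ha, ← ENNReal.ofReal_mul (by positivity),
    ← ENNReal.ofReal_mul (by positivity), norm_kernel ha, norm_kernel hz, hconj,
    Real.div_rpow ha1.le hpos.le, Real.div_rpow hz1.le hpos.le, Real.rpow_neg hz1.le]
  congr 1
  field_simp

/-- A Euclidean disc about `a` of radius proportional to the distance from `a` to the circle, hence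
comparable to a hyperbolic disc of fixed radius. -/
def whitneyDisc (δ : ℝ) (a : ℂ) : Set ℂ := closedBall a (δ * (1 - ‖a‖))

theorem measurableSet_whitneyDisc (δ : ℝ) (a : ℂ) : MeasurableSet (whitneyDisc δ a) :=
  measurableSet_closedBall

theorem one_sub_norm_mem_Icc {δ : ℝ} {a w : ℂ} (hw : w ∈ whitneyDisc δ a) :
    1 - ‖w‖ ∈ Icc ((1 - δ) * (1 - ‖a‖)) ((1 + δ) * (1 - ‖a‖)) := by
  have h := (abs_le.1 ((abs_norm_sub_norm_le w a).trans (mem_closedBall_iff_norm.1 hw)))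
  constructor <;> linarith [h.1, h.2]

theorem whitneyDisc_subset_disc {δ : ℝ} {a : ℂ} (hδ : δ < 1) (ha : a ∈ disc) :
    whitneyDisc δ a ⊆ disc := fun _ hw =>
  mem_disc.2 <| sub_pos.1 <|
    (mul_pos (sub_pos.2 hδ) (sub_pos.2 (mem_disc.1 ha))).trans_le (one_sub_norm_mem_Icc hw).1

theorem IsNormalWeight.exists_le_of_mem_whitneyDisc {v : ℝ → ℝ} {a b : ℝ}
    (h : IsNormalWeight v a b) {δ : ℝ} (hδ : δ < 1) :
    ∃ K : ℝ, 0 ≤ K ∧ ∀ c ∈ disc, ∀ w ∈ whitneyDisc δ c, v ‖c‖ ≤ K * v ‖w‖ := by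
  by_cases hδ0 : 0 ≤ δ
  swap
  · refine ⟨0, le_rfl, fun c hc w hw => ?_⟩
    rw [whitneyDisc, closedBall_eq_empty.2] at hw
    · exact hw.elim
    · exact mul_neg_of_neg_of_pos (not_le.1 hδ0) (sub_pos.2 (mem_disc.1 hc))
  have hcont : ContinuousOn (fun x : ℝ => x ^ (a - 1) + x ^ (b - 1))
      (Icc (1 / (1 + δ)) (1 / (1 - δ))) := by
    have hpos : ∀ x ∈ Icc (1 / (1 + δ)) (1 / (1 - δ)), x ≠ 0 :=
      fun x hx => ((by positivity : 0 < 1 / (1 + δ)).trans_le hx.1).ne'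
    exact (continuousOn_id.rpow_const fun x hx => Or.inl (hpos x hx)).add
      (continuousOn_id.rpow_const fun x hx => Or.inl (hpos x hx))
  obtain ⟨K, hK⟩ := isCompact_Icc.bddAbove_image hcont
  refine ⟨max K 0, le_max_right _ _, fun c hc w hw => ?_⟩
  have hw' := whitneyDisc_subset_disc hδ hc hw
  have hw1 : 0 < 1 - ‖w‖ := sub_pos.2 (mem_disc.1 hw')
  have hδ1 : 0 < 1 - δ := sub_pos.2 hδ
  have hbounds := one_sub_norm_mem_Icc hw
  have hratio : (1 - ‖c‖) / (1 - ‖w‖) ∈ Icc (1 / (1 + δ)) (1 / (1 - δ)) := by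
    rw [mem_Icc, div_le_div_iff₀ (by positivity) hw1, div_le_div_iff₀ hw1 hδ1]
    constructor <;> linarith [hbounds.1, hbounds.2]
  have hv := h.pos _ (norm_mem_Ico hw')
  calc v ‖c‖ ≤ v ‖w‖ * _ := h.le_mul_rpow_add_rpow (norm_mem_Ico hc) (norm_mem_Ico hw')
    _ ≤ v ‖w‖ * max K 0 := by
        gcongr
        exact (hK (mem_image_of_mem _ hratio)).trans (le_max_left _ _)
    _ = _ := mul_comm _ _

theorem ofReal_one_sub_sq_eq_mul_volume_ball {δ : ℝ} (hδ : 0 < δ) {c : ℂ} (hc : c ∈ disc) (z : ℂ) :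
    ENNReal.ofReal ((1 - ‖c‖) ^ 2) =
      ENNReal.ofReal ((δ ^ 2)⁻¹) * ENNReal.ofReal Real.pi⁻¹ * volume (ball z (δ * (1 - ‖c‖))) := by
  have hc1 : 0 < 1 - ‖c‖ := sub_pos.2 (mem_disc.1 hc)
  rw [Complex.volume_ball, ← ENNReal.ofReal_pow (by positivity), ← ENNReal.ofReal_coe_nnreal,
    NNReal.coe_real_pi, ← ENNReal.ofReal_mul (by positivity), ← ENNReal.ofReal_mul (by positivity),
    ← ENNReal.ofReal_mul (by positivity)]
  congr 1
  field_simp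

theorem IsNormalWeight.exists_cellWeight_mul_enorm_rpow_le {v : ℝ → ℝ} {a b δ p : ℝ}
    (h : IsNormalWeight v a b) (hδ : 0 < δ) (hδ1 : 2 * δ < 1) (hp : 0 < p) :
    ∃ C : ℝ≥0, ∀ f : ℂ → ℂ, DifferentiableOn ℂ f disc → ∀ c ∈ disc, ∀ z ∈ whitneyDisc δ c,
      cellWeight v c * ‖f z‖ₑ ^ p ≤
        C * ∫⁻ w in whitneyDisc (2 * δ) c, ‖f w‖ₑ ^ p ∂weightMeasure v := by
  obtain ⟨K, hK0, hK⟩ := h.exists_le_of_mem_whitneyDisc hδ1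
  refine ⟨Real.toNNReal (K * (δ ^ 2)⁻¹), fun f hf c hc z hz => ?_⟩
  have hc1 : 0 < 1 - ‖c‖ := sub_pos.2 (mem_disc.1 hc)
  have hball : ball z (δ * (1 - ‖c‖)) ⊆ whitneyDisc (2 * δ) c :=
    ball_subset_closedBall.trans <| closedBall_subset_closedBall' <| by
      linarith [mem_closedBall.1 hz]
  have hdisc := whitneyDisc_subset_disc hδ1 hc
  calc cellWeight v c * ‖f z‖ₑ ^ p
      = ENNReal.ofReal ((δ ^ 2)⁻¹) * ENNReal.ofReal Real.pi⁻¹ * (ENNReal.ofReal (v ‖c‖) *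
          (‖f z‖ₑ ^ p * volume (ball z (δ * (1 - ‖c‖))))) := by
        rw [cellWeight, ENNReal.ofReal_mul (by positivity),
          ofReal_one_sub_sq_eq_mul_volume_ball hδ hc z]
        ring
    _ ≤ ENNReal.ofReal ((δ ^ 2)⁻¹) * ENNReal.ofReal Real.pi⁻¹ * (ENNReal.ofReal (v ‖c‖) *
          ∫⁻ w in whitneyDisc (2 * δ) c, ‖f w‖ₑ ^ p) := by
        gcongr
        exact (enorm_rpow_mul_volume_le_lintegral_ball hp (hf.mono (hball.trans hdisc))).trans
          (lintegral_mono_set hball)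
    _ ≤ ENNReal.ofReal ((δ ^ 2)⁻¹) * ENNReal.ofReal Real.pi⁻¹ * (ENNReal.ofReal K *
          ∫⁻ w in whitneyDisc (2 * δ) c, ENNReal.ofReal (v ‖w‖) * ‖f w‖ₑ ^ p) := by
        rw [← lintegral_const_mul' _ _ ENNReal.ofReal_ne_top,
          ← lintegral_const_mul' _ _ ENNReal.ofReal_ne_top]
        refine mul_le_mul_right (setLIntegral_mono' (measurableSet_whitneyDisc _ _)
          fun w hw => ?_) _
        rw [← mul_assoc, ← ENNReal.ofReal_mul hK0]
        gcongr
        exact hK c hc w hw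
    _ = _ := by
        rw [setLIntegral_weightMeasure h.measurable (measurableSet_whitneyDisc _ _) hdisc,
          ← ENNReal.ofReal.eq_def, ENNReal.ofReal_mul hK0]
        ring

theorem one_third_le_norm_kernel {δ : ℝ} {a z : ℂ} (hδ : δ ≤ 1) (ha : a ∈ disc) (hz : z ∈ disc)
    (hza : z ∈ whitneyDisc δ a) : 1 / 3 ≤ ‖kernel a z‖ := by
  have ha1 : 0 < 1 - ‖a‖ := sub_pos.2 (mem_disc.1 ha)
  have hza' : ‖a - z‖ ≤ 1 - ‖a‖ :=
    (mem_closedBall_iff_norm'.1 hza).trans (mul_le_of_le_one_left ha1.le hδ)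
  have hle : ‖1 - (starRingEnd ℂ) a * z‖ ≤ 3 * (1 - ‖a‖) := by
    calc _ = ‖((1 - ‖a‖ ^ 2 : ℝ) : ℂ) + (starRingEnd ℂ) a * (a - z)‖ := by
          rw [mul_sub, Complex.conj_mul']
          push_cast
          ring_nf
      _ ≤ (1 - ‖a‖ ^ 2) + ‖a‖ * ‖a - z‖ := by
          refine (norm_add_le _ _).trans_eq ?_
          rw [Complex.norm_of_nonneg (by nlinarith [norm_nonneg a]), norm_mul, RCLike.norm_conj]
      _ ≤ _ := by nlinarith [norm_nonneg a, norm_nonneg (a - z)]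
  rw [norm_kernel ha, div_le_div_iff₀ three_pos (norm_pos_iff.2 (one_sub_conj_mul_ne_zero ha hz))]
  linarith

/-- A separated set of points of the disc whose Whitney discs cover the disc. The radii are those
produced by the Vitali covering lemma, which enlarges disjoint balls by the factor `5`. -/
structure IsLattice (u : Set ℂ) : Prop where
  subset_disc : u ⊆ disc
  pairwiseDisjoint : u.PairwiseDisjoint (whitneyDisc (1 / 100))
  exists_mem_whitneyDisc : ∀ z ∈ disc, ∃ a ∈ u, z ∈ whitneyDisc (1 / 20) a

theorem exists_isLattice : ∃ u : Set ℂ, IsLattice u := by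
  obtain ⟨u, hu, hdisjoint, hcover⟩ :=
    Vitali.exists_disjoint_subfamily_covering_enlargement_closedBall
      disc id (fun a => 1 / 100 * (1 - ‖a‖)) 1 (fun a _ => by linarith [norm_nonneg a]) 5
      (by norm_num)
  refine ⟨u, hu, hdisjoint, fun z hz => ?_⟩
  obtain ⟨a, ha, hsub⟩ := hcover z hz
  have hz1 : 0 < 1 - ‖z‖ := sub_pos.2 (mem_disc.1 hz)
  refine ⟨a, ha, ?_⟩
  rw [whitneyDisc, show 1 / 20 * (1 - ‖a‖) = 5 * (1 / 100 * (1 - ‖a‖)) by ring]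
  exact hsub (mem_closedBall_self (by positivity))

namespace IsLattice

variable {u : Set ℂ}

theorem countable (hu : IsLattice u) : u.Countable := by
  refine hu.pairwiseDisjoint.countable_of_nonempty_interior fun a ha => ?_
  have ha1 : 0 < 1 - ‖a‖ := sub_pos.2 (mem_disc.1 (hu.subset_disc ha))
  exact ⟨a, ball_subset_interior_closedBall (mem_ball_self (by positivity))⟩

theorem exists_sum_cellWeight_mul_enorm_rpow_le (hu : IsLattice u) {v : ℝ → ℝ} {a b p : ℝ}
    (h : IsNormalWeight v a b) (hp : 0 < p) :
    ∃ C : ℝ≥0, ∀ f : ℂ → ℂ, DifferentiableOn ℂ f disc → ∀ s : Finset ℂ, (s : Set ℂ) ⊆ u →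
      ∑ c ∈ s, cellWeight v c * ‖f c‖ₑ ^ p ≤ C * ∫⁻ w, ‖f w‖ₑ ^ p ∂weightMeasure v := by
  obtain ⟨C, hC⟩ := h.exists_cellWeight_mul_enorm_rpow_le (δ := 1 / 200) (by norm_num)
    (by norm_num) hp
  refine ⟨C, fun f hf s hs => ?_⟩
  rw [show (2 * (1 / 200) : ℝ) = 1 / 100 by norm_num] at hC
  calc ∑ c ∈ s, cellWeight v c * ‖f c‖ₑ ^ p
      ≤ ∑ c ∈ s, C * ∫⁻ w in whitneyDisc (1 / 100) c, ‖f w‖ₑ ^ p ∂weightMeasure v := by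
        refine Finset.sum_le_sum fun c hc => ?_
        have hc' := hu.subset_disc (hs hc)
        have hc1 : 0 < 1 - ‖c‖ := sub_pos.2 (mem_disc.1 hc')
        exact hC f hf c hc' c (mem_closedBall_self (by positivity))
    _ ≤ _ := by
        rw [← Finset.mul_sum, ← lintegral_biUnion_finset (hu.pairwiseDisjoint.subset hs)
          fun _ _ => measurableSet_whitneyDisc _ _]
        exact mul_le_mul_right (setLIntegral_le_lintegral _ _) _

theorem exists_sum_one_sub_rpow_mul_kernel_rpow_le (hu : IsLattice u) {ε M : ℝ} (hε : 0 < ε)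
    (hM : 2 ≤ M) (hεM : ε + 1 < M) :
    ∃ C : ℝ≥0, ∀ s : Finset ℂ, (s : Set ℂ) ⊆ u → ∀ z ∈ disc,
      ∑ a ∈ s, ENNReal.ofReal ((1 - ‖a‖) ^ (-ε)) * ‖kernel a z‖ₑ ^ M ≤
        C * ENNReal.ofReal ((1 - ‖z‖) ^ (-ε)) := by
  have hv : IsNormalWeight (fun r => (1 - r) ^ (M - 2 - ε)) (M - 2 - ε + 1) (M - 2 - ε + 1) :=
    .one_sub_rpow (by linarith)
  obtain ⟨A, hA⟩ := hu.exists_sum_cellWeight_mul_enorm_rpow_le hv (by linarith : 0 < M)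
  obtain ⟨B, hB⟩ := hv.lintegral_kernel_rpow_le hM (by linarith)
  refine ⟨A * B, fun s hs z hz => ?_⟩
  have hz1 : 0 < 1 - ‖z‖ := sub_pos.2 (mem_disc.1 hz)
  -- Exchanging the two points turns the sum into values of the analytic function `kernel z`.
  have hexchange (a : ℂ) (ha : a ∈ s) :
      ENNReal.ofReal ((1 - ‖a‖) ^ (-ε)) * ‖kernel a z‖ₑ ^ M =
        ENNReal.ofReal ((1 - ‖z‖) ^ (-M)) *
          (cellWeight (fun r => (1 - r) ^ (M - 2 - ε)) a * ‖kernel z a‖ₑ ^ M) := by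
    have ha1 : 0 < 1 - ‖a‖ := sub_pos.2 (mem_disc.1 (hu.subset_disc (hs ha)))
    rw [enorm_kernel_rpow_comm (hu.subset_disc (hs ha)) hz, cellWeight_one_sub_rpow ha1,
      ← mul_assoc, ← mul_assoc, ← mul_assoc, mul_comm (ENNReal.ofReal ((1 - ‖z‖) ^ (-M))),
      ← ENNReal.ofReal_mul (by positivity), ← Real.rpow_add ha1]
    congr 4
    ring
  calc _ = ENNReal.ofReal ((1 - ‖z‖) ^ (-M)) *
          ∑ a ∈ s, cellWeight (fun r => (1 - r) ^ (M - 2 - ε)) a * ‖kernel z a‖ₑ ^ M := by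
        rw [Finset.mul_sum, Finset.sum_congr rfl hexchange]
    _ ≤ ENNReal.ofReal ((1 - ‖z‖) ^ (-M)) *
          (A * (B * cellWeight (fun r => (1 - r) ^ (M - 2 - ε)) z)) := by
        gcongr
        exact (hA _ (differentiableOn_kernel hz) s hs).trans (mul_le_mul_right (hB z hz) _)
    _ = _ := by
        rw [cellWeight_one_sub_rpow hz1, ← mul_assoc (A : ℝ≥0∞), ← ENNReal.coe_mul, mul_left_comm,
          ← ENNReal.ofReal_mul (by positivity), ← Real.rpow_add hz1]
        congr 3
        ring

theorem exists_sum_indicator_whitneyDisc_le (hu : IsLattice u) :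
    ∃ N : ℝ≥0, ∀ s : Finset ℂ, (s : Set ℂ) ⊆ u → ∀ z ∈ disc,
      ∑ a ∈ s, (whitneyDisc (1 / 10) a).indicator (1 : ℂ → ℝ≥0∞) z ≤ N := by
  obtain ⟨C, hC⟩ := hu.exists_sum_one_sub_rpow_mul_kernel_rpow_le one_pos (by norm_num)
    (by norm_num : (1 : ℝ) + 1 < 3)
  refine ⟨30 * C, fun s hs z hz => ?_⟩
  have hz1 : 0 < 1 - ‖z‖ := sub_pos.2 (mem_disc.1 hz)
  have hterm (a : ℂ) (ha : a ∈ s) : (whitneyDisc (1 / 10) a).indicator (1 : ℂ → ℝ≥0∞) z ≤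
      ENNReal.ofReal (30 * (1 - ‖z‖)) *
        (ENNReal.ofReal ((1 - ‖a‖) ^ (-1 : ℝ)) * ‖kernel a z‖ₑ ^ (3 : ℝ)) := by
    refine indicator_apply_le' (fun hza => ?_) fun _ => zero_le
    have ha' := hu.subset_disc (hs ha)
    have ha1 : 0 < 1 - ‖a‖ := sub_pos.2 (mem_disc.1 ha')
    rw [← ofReal_norm, ENNReal.ofReal_rpow_of_nonneg (norm_nonneg _) (by norm_num),
      ← ENNReal.ofReal_mul (by positivity), ← ENNReal.ofReal_mul (by positivity), Pi.one_apply,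
      ENNReal.one_le_ofReal]
    calc (1 : ℝ) = 30 * (9 / 10 * (1 - ‖a‖)) * ((1 - ‖a‖) ^ (-1 : ℝ) * (1 / 3) ^ (3 : ℝ)) := by
          rw [Real.rpow_neg_one]
          norm_num
          field_simp
          norm_num
      _ ≤ _ := by
          gcongr
          · linarith [(one_sub_norm_mem_Icc hza).1]
          · exact one_third_le_norm_kernel (by norm_num) ha' hz hza
  calc _ ≤ ENNReal.ofReal (30 * (1 - ‖z‖)) * ∑ a ∈ s,
          ENNReal.ofReal ((1 - ‖a‖) ^ (-1 : ℝ)) * ‖kernel a z‖ₑ ^ (3 : ℝ) := by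
        rw [Finset.mul_sum]
        exact Finset.sum_le_sum hterm
    _ ≤ ENNReal.ofReal (30 * (1 - ‖z‖)) * (C * ENNReal.ofReal ((1 - ‖z‖) ^ (-1 : ℝ))) := by
        gcongr
        exact hC s hs z hz
    _ = _ := by
        rw [mul_left_comm, ← ENNReal.ofReal_mul (by positivity), Real.rpow_neg_one,
          mul_inv_cancel_right₀ hz1.ne', ENNReal.coe_mul, mul_comm]
        norm_num

theorem exists_sum_setLIntegral_whitneyDisc_le (hu : IsLattice u) :
    ∃ N : ℝ≥0, ∀ (ν : Measure ℂ) (g : ℂ → ℝ≥0∞), AEMeasurable g (ν.restrict disc) →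
      ∀ s : Finset ℂ, (s : Set ℂ) ⊆ u →
        ∑ a ∈ s, ∫⁻ z in whitneyDisc (1 / 10) a, g z ∂ν ≤ N * ∫⁻ z in disc, g z ∂ν := by
  obtain ⟨N, hN⟩ := hu.exists_sum_indicator_whitneyDisc_le
  refine ⟨N, fun ν g hg s hs => ?_⟩
  calc ∑ a ∈ s, ∫⁻ z in whitneyDisc (1 / 10) a, g z ∂ν
      = ∑ a ∈ s, ∫⁻ z in disc, (whitneyDisc (1 / 10) a).indicator 1 z * g z ∂ν := by
        refine Finset.sum_congr rfl fun a ha => ?_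
        simp_rw [← indicator_mul_left, Pi.one_apply, one_mul]
        rw [setLIntegral_indicator (measurableSet_whitneyDisc _ _), inter_eq_left.2
          (whitneyDisc_subset_disc (by norm_num) (hu.subset_disc (hs ha)))]
    _ = ∫⁻ z in disc, (∑ a ∈ s, (whitneyDisc (1 / 10) a).indicator 1 z) * g z ∂ν := by
        simp_rw [Finset.sum_mul]
        exact (lintegral_finsetSum' s fun a _ => ((measurable_one.indicator
          (measurableSet_whitneyDisc _ _)).aemeasurable.mul hg)).symm
    _ ≤ ∫⁻ z in disc, N * g z ∂ν :=
        setLIntegral_mono' measurableSet_disc fun z hz => mul_le_mul_left (hN s hs z hz) _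
    _ = _ := lintegral_const_mul' _ _ ENNReal.coe_ne_top

end IsLattice

theorem rpow_sum_le_sum_rpow {ι : Type*} (s : Finset ι) (x : ι → ℝ≥0∞) {p : ℝ} (hp : 0 < p)
    (hp1 : p ≤ 1) : (∑ i ∈ s, x i) ^ p ≤ ∑ i ∈ s, x i ^ p :=
  Finset.le_sum_of_subadditive (· ^ p) (ENNReal.zero_rpow_of_pos hp).le
    (fun _ _ => ENNReal.rpow_add_le_add_rpow _ _ hp.le hp1) s x

theorem rpow_sum_mul_le {ι : Type*} (s : Finset ι) (w f : ι → ℝ≥0∞) {p : ℝ} (hp : 1 ≤ p) :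
    (∑ i ∈ s, w i * f i) ^ p ≤ (∑ i ∈ s, w i) ^ (p - 1) * ∑ i ∈ s, w i * f i ^ p := by
  have hp0 : 0 < p := by linarith
  have h := ENNReal.rpow_le_rpow (ENNReal.inner_le_weight_mul_Lp_of_nonneg s hp w f) hp0.le
  rwa [ENNReal.mul_rpow_of_nonneg _ _ hp0.le, ← ENNReal.rpow_mul, ← ENNReal.rpow_mul, sub_mul,
    one_mul, inv_mul_cancel₀ hp0.ne', ENNReal.rpow_one] at h

theorem restrict_weightMeasure_disc (v : ℝ → ℝ) :
    (weightMeasure v).restrict disc = weightMeasure v := by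
  rw [weightMeasure, restrict_withDensity measurableSet_disc, areaMeasure, Measure.restrict_smul,
    Measure.restrict_restrict measurableSet_disc, inter_self]

theorem ae_weightMeasure_mem_disc (v : ℝ → ℝ) : ∀ᵐ z ∂weightMeasure v, z ∈ disc := by
  rw [← restrict_weightMeasure_disc]
  exact ae_restrict_mem measurableSet_disc

theorem lintegral_weightMeasure_one_sub_rpow_mul {v : ℝ → ℝ} (hv : Measurable v) (e : ℝ)
    (g : ℂ → ℝ≥0∞) :
    ∫⁻ z, g z ∂weightMeasure (fun r => (1 - r) ^ e * v r) =
      ∫⁻ z, ENNReal.ofReal ((1 - ‖z‖) ^ e) * g z ∂weightMeasure v := by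
  rw [lintegral_weightMeasure hv, lintegral_weightMeasure (by fun_prop)]
  congr 1
  refine setLIntegral_congr_fun measurableSet_disc fun z hz => ?_
  have hz1 : 0 < 1 - ‖z‖ := sub_pos.2 (mem_disc.1 hz)
  rw [ENNReal.ofReal_mul (by positivity), mul_left_comm, mul_assoc]

theorem ofReal_mul_cellWeight_one_sub_rpow_mul {v : ℝ → ℝ} {a : ℂ} (ha : a ∈ disc) (e : ℝ) :
    ENNReal.ofReal ((1 - ‖a‖) ^ e) * cellWeight (fun r => (1 - r) ^ (-e) * v r) a =
      cellWeight v a := by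
  have ha1 : 0 < 1 - ‖a‖ := sub_pos.2 (mem_disc.1 ha)
  rw [cellWeight, ← ENNReal.ofReal_mul (by positivity), Real.rpow_neg ha1.le, cellWeight]
  congr 1
  field_simp

/-- Atomic sums over a finite set of points of the disc, the source of test functions in weighted
Bergman spaces. -/
def kernelSum (m : ℕ) (s : Finset ℂ) (c : ℂ → ℂ) (z : ℂ) : ℂ := ∑ a ∈ s, c a * kernel a z ^ m

theorem differentiableOn_kernelSum (m : ℕ) {s : Finset ℂ} (hs : (s : Set ℂ) ⊆ disc) (c : ℂ → ℂ) :
    DifferentiableOn ℂ (kernelSum m s c) disc :=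
  DifferentiableOn.fun_sum fun _ ha => ((differentiableOn_kernel (hs ha)).pow m).const_mul _

theorem enorm_kernelSum_le (m : ℕ) (s : Finset ℂ) (c : ℂ → ℂ) (z : ℂ) :
    ‖kernelSum m s c z‖ₑ ≤ ∑ a ∈ s, ‖c a‖ₑ * ‖kernel a z‖ₑ ^ (m : ℝ) :=
  (enorm_sum_le _ _).trans_eq <| Finset.sum_congr rfl fun _ _ => by
    rw [enorm_mul, enorm_pow, ENNReal.rpow_natCast]

theorem IsNormalWeight.exists_lintegral_kernelSum_le_of_le_one {v : ℝ → ℝ} {a b : ℝ}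
    (h : IsNormalWeight v a b) {p : ℝ} (hp : 0 < p) (hp1 : p ≤ 1) {m : ℕ} (hm2 : 2 ≤ m * p)
    (hm : b + 1 < m * p) :
    ∃ C : ℝ≥0, ∀ s : Finset ℂ, (s : Set ℂ) ⊆ disc → ∀ c : ℂ → ℂ,
      ∫⁻ z, ‖kernelSum m s c z‖ₑ ^ p ∂weightMeasure v ≤
        C * ∑ α ∈ s, ‖c α‖ₑ ^ p * cellWeight v α := by
  obtain ⟨C, hC⟩ := h.lintegral_kernel_rpow_le hm2 hm
  refine ⟨C, fun s hs c => ?_⟩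
  have hpoint (z : ℂ) : ‖kernelSum m s c z‖ₑ ^ p ≤
      ∑ α ∈ s, ‖c α‖ₑ ^ p * ‖kernel α z‖ₑ ^ (m * p) :=
    calc _ ≤ (∑ α ∈ s, ‖c α‖ₑ * ‖kernel α z‖ₑ ^ (m : ℝ)) ^ p := by
          gcongr
          exact enorm_kernelSum_le m s c z
      _ ≤ ∑ α ∈ s, (‖c α‖ₑ * ‖kernel α z‖ₑ ^ (m : ℝ)) ^ p := rpow_sum_le_sum_rpow s _ hp hp1
      _ = _ := by simp_rw [ENNReal.mul_rpow_of_nonneg _ _ hp.le, ENNReal.rpow_mul]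
  calc _ ≤ ∫⁻ z, ∑ α ∈ s, ‖c α‖ₑ ^ p * ‖kernel α z‖ₑ ^ (m * p) ∂weightMeasure v :=
        lintegral_mono hpoint
    _ = ∑ α ∈ s, ‖c α‖ₑ ^ p * ∫⁻ z, ‖kernel α z‖ₑ ^ (m * p) ∂weightMeasure v := by
        rw [lintegral_finsetSum _ fun α _ => by fun_prop]
        exact Finset.sum_congr rfl fun α _ => lintegral_const_mul _ (by fun_prop)
    _ ≤ ∑ α ∈ s, ‖c α‖ₑ ^ p * (C * cellWeight v α) := by
        gcongr with α hα
        exact hC α (hs hα)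
    _ = _ := by simp_rw [Finset.mul_sum, mul_left_comm]

namespace IsLattice

variable {u : Set ℂ}

theorem exists_enorm_kernelSum_rpow_le (hu : IsLattice u) {p ε : ℝ} (hp : 1 ≤ p) (hε : 0 < ε)
    {m : ℕ} (hm2 : (2 : ℝ) ≤ m) (hm : ε + 1 < m) :
    ∃ D : ℝ≥0, ∀ s : Finset ℂ, (s : Set ℂ) ⊆ u → ∀ (c : ℂ → ℂ), ∀ z ∈ disc,
      ‖kernelSum m s c z‖ₑ ^ p ≤ D * ∑ α ∈ s, ‖c α‖ₑ ^ p *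
        ENNReal.ofReal ((1 - ‖α‖) ^ (ε * (p - 1))) *
          (ENNReal.ofReal ((1 - ‖z‖) ^ (-(ε * (p - 1)))) * ‖kernel α z‖ₑ ^ (m : ℝ)) := by
  have hp0 : 0 ≤ p := by linarith
  have hp1 : 0 ≤ p - 1 := by linarith
  obtain ⟨D, hD⟩ := hu.exists_sum_one_sub_rpow_mul_kernel_rpow_le hε hm2 hm
  refine ⟨D ^ (p - 1), fun s hs c z hz => ?_⟩
  have hz1 : 0 < 1 - ‖z‖ := sub_pos.2 (mem_disc.1 hz)
  have hs1 (α : ℂ) (hα : α ∈ s) : 0 < 1 - ‖α‖ := sub_pos.2 (mem_disc.1 (hu.subset_disc (hs hα)))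
  have hsplit : ‖kernelSum m s c z‖ₑ ≤ ∑ α ∈ s,
      ENNReal.ofReal ((1 - ‖α‖) ^ (-ε)) * ‖kernel α z‖ₑ ^ (m : ℝ) *
        (ENNReal.ofReal ((1 - ‖α‖) ^ ε) * ‖c α‖ₑ) := by
    refine (enorm_kernelSum_le m s c z).trans_eq (Finset.sum_congr rfl fun α hα => ?_)
    have := hs1 α hα
    rw [mul_mul_mul_comm, ← ENNReal.ofReal_mul (by positivity), ← Real.rpow_add this,
      neg_add_cancel, Real.rpow_zero, ENNReal.ofReal_one, one_mul, mul_comm]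
  calc _ ≤ (∑ α ∈ s, ENNReal.ofReal ((1 - ‖α‖) ^ (-ε)) * ‖kernel α z‖ₑ ^ (m : ℝ)) ^ (p - 1) *
          ∑ α ∈ s, ENNReal.ofReal ((1 - ‖α‖) ^ (-ε)) * ‖kernel α z‖ₑ ^ (m : ℝ) *
            (ENNReal.ofReal ((1 - ‖α‖) ^ ε) * ‖c α‖ₑ) ^ p :=
        (ENNReal.rpow_le_rpow hsplit hp0).trans (rpow_sum_mul_le s _ _ hp)
    _ ≤ (D * ENNReal.ofReal ((1 - ‖z‖) ^ (-ε))) ^ (p - 1) *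
          ∑ α ∈ s, ENNReal.ofReal ((1 - ‖α‖) ^ (-ε)) * ‖kernel α z‖ₑ ^ (m : ℝ) *
            (ENNReal.ofReal ((1 - ‖α‖) ^ ε) * ‖c α‖ₑ) ^ p := by
        gcongr
        exact hD s hs z hz
    _ = _ := by
        rw [ENNReal.mul_rpow_of_nonneg _ _ hp1, ← ENNReal.coe_rpow_of_nonneg _ hp1, mul_assoc,
          Finset.mul_sum]
        congr 1
        refine Finset.sum_congr rfl fun α hα => ?_
        have hα1 := hs1 α hα
        have hexp : (1 - ‖α‖) ^ (ε * (p - 1)) = (1 - ‖α‖) ^ (-ε) * ((1 - ‖α‖) ^ ε) ^ p := by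
          rw [← Real.rpow_mul hα1.le, ← Real.rpow_add hα1]
          ring_nf
        rw [ENNReal.mul_rpow_of_nonneg _ _ hp0, ENNReal.ofReal_rpow_of_pos (by positivity),
          ENNReal.ofReal_rpow_of_pos (by positivity), hexp, ← neg_mul, Real.rpow_mul hz1.le,
          ENNReal.ofReal_mul (by positivity)]
        ring

theorem exists_lintegral_kernelSum_le_of_one_le (hu : IsLattice u) {v : ℝ → ℝ} {a b : ℝ}
    (h : IsNormalWeight v a b) {p ε : ℝ} (hp : 1 ≤ p) (hε : 0 < ε) (hεa : ε * (p - 1) < a) {m : ℕ}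
    (hm2 : (2 : ℝ) ≤ m) (hεm : ε + 1 < m) (hm : b + 1 < m) :
    ∃ C : ℝ≥0, ∀ s : Finset ℂ, (s : Set ℂ) ⊆ u → ∀ c : ℂ → ℂ,
      ∫⁻ z, ‖kernelSum m s c z‖ₑ ^ p ∂weightMeasure v ≤
        C * ∑ α ∈ s, ‖c α‖ₑ ^ p * cellWeight v α := by
  have hεp : 0 ≤ ε * (p - 1) := mul_nonneg hε.le (by linarith)
  have hnormal := h.one_sub_rpow_mul (e := -(ε * (p - 1))) (by linarith)
  obtain ⟨C, hC⟩ := hnormal.lintegral_kernel_rpow_le hm2 (by linarith)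
  obtain ⟨D, hD⟩ := hu.exists_enorm_kernelSum_rpow_le hp hε hm2 hεm
  refine ⟨D * C, fun s hs c => ?_⟩
  calc _ ≤ ∫⁻ z, D * ∑ α ∈ s, ‖c α‖ₑ ^ p * ENNReal.ofReal ((1 - ‖α‖) ^ (ε * (p - 1))) *
          (ENNReal.ofReal ((1 - ‖z‖) ^ (-(ε * (p - 1)))) * ‖kernel α z‖ₑ ^ (m : ℝ))
            ∂weightMeasure v :=
        lintegral_mono_ae ((ae_weightMeasure_mem_disc v).mono fun z hz => hD s hs c z hz)
    _ = D * ∑ α ∈ s, ‖c α‖ₑ ^ p * ENNReal.ofReal ((1 - ‖α‖) ^ (ε * (p - 1))) *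
          ∫⁻ z, ‖kernel α z‖ₑ ^ (m : ℝ) ∂weightMeasure
            (fun r => (1 - r) ^ (-(ε * (p - 1))) * v r) := by
        rw [lintegral_const_mul _ (by fun_prop), lintegral_finsetSum _ fun α _ => by fun_prop]
        simp_rw [lintegral_weightMeasure_one_sub_rpow_mul h.measurable]
        congr 1
        exact Finset.sum_congr rfl fun α _ => lintegral_const_mul _ (by fun_prop)
    _ ≤ D * ∑ α ∈ s, ‖c α‖ₑ ^ p * ENNReal.ofReal ((1 - ‖α‖) ^ (ε * (p - 1))) *
          (C * cellWeight (fun r => (1 - r) ^ (-(ε * (p - 1))) * v r) α) := by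
        gcongr with α hα
        exact hC α (hu.subset_disc (hs hα))
    _ = _ := by
        rw [ENNReal.coe_mul, mul_assoc, Finset.mul_sum s _ (C : ℝ≥0∞)]
        congr 1
        refine Finset.sum_congr rfl fun α hα => ?_
        rw [← ofReal_mul_cellWeight_one_sub_rpow_mul (v := v) (hu.subset_disc (hs hα))
          (ε * (p - 1))]
        ring

theorem exists_lintegral_kernelSum_le (hu : IsLattice u) {v : ℝ → ℝ} {a b : ℝ}
    (h : IsNormalWeight v a b) {p : ℝ} (hp : 0 < p) :
    ∃ (m : ℕ) (C : ℝ≥0), ∀ s : Finset ℂ, (s : Set ℂ) ⊆ u → ∀ c : ℂ → ℂ,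
      ∫⁻ z, ‖kernelSum m s c z‖ₑ ^ p ∂weightMeasure v ≤
        C * ∑ α ∈ s, ‖c α‖ₑ ^ p * cellWeight v α := by
  have ha := h.exponent_pos
  have hb := ha.trans_le h.exponent_le
  rcases le_total p 1 with hp1 | hp1
  · obtain ⟨m, hm⟩ := exists_nat_gt ((b + 2) / p)
    rw [div_lt_iff₀ hp] at hm
    obtain ⟨C, hC⟩ := h.exists_lintegral_kernelSum_le_of_le_one hp hp1 (m := m) (by linarith)
      (by linarith)
    exact ⟨m, C, fun s hs => hC s (hs.trans hu.subset_disc)⟩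
  · have hεa : a / p * (p - 1) < a := by
      rw [mul_sub, div_mul_cancel₀ _ hp.ne', mul_one]
      exact sub_lt_self _ (by positivity)
    have hε : 0 < a / p := by positivity
    obtain ⟨m, hm⟩ := exists_nat_gt (b + a / p + 2)
    exact ⟨m, hu.exists_lintegral_kernelSum_le_of_one_le h hp1 hε hεa (by linarith)
      (by linarith) (by linarith)⟩

end IsLattice

theorem card_powerset_mul_enorm_rpow_le {ι E : Type*} [SeminormedAddCommGroup E]
    {s : Finset ι} (x : ι → E) {q : ℝ} (hq : 0 ≤ q) {k : ι} (hk : k ∈ s) :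
    (s.powerset.card : ℝ≥0∞) * ‖x k‖ₑ ^ q ≤
      2 ^ q * 2 * ∑ t ∈ s.powerset, ‖∑ j ∈ t, x j‖ₑ ^ q := by
  classical
  have hmem (t : Finset ι) (ht : t ∈ s.powerset) : symmDiff t {k} ∈ s.powerset :=
    Finset.mem_powerset.2 <| symmDiff_le_sup.trans <|
      sup_le (Finset.mem_powerset.1 ht) (Finset.singleton_subset_iff.2 hk)
  have hnorm (t : Finset ι) : ‖x k‖ₑ ≤ ‖∑ j ∈ t, x j‖ₑ + ‖∑ j ∈ symmDiff t {k}, x j‖ₑ := by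
    by_cases ht : k ∈ t
    · rw [show symmDiff t {k} = t.erase k by grind [Finset.mem_symmDiff],
        ← add_sub_cancel_left (∑ j ∈ t.erase k, x j) (x k), Finset.sum_erase_add t x ht]
      exact enorm_sub_le
    · rw [show symmDiff t {k} = insert k t by grind [Finset.mem_symmDiff], add_comm,
        ← add_sub_cancel_right (x k) (∑ j ∈ t, x j), ← Finset.sum_insert ht]
      exact enorm_sub_le
  have hpair (t : Finset ι) : ‖x k‖ₑ ^ q ≤
      2 ^ q * (‖∑ j ∈ t, x j‖ₑ ^ q + ‖∑ j ∈ symmDiff t {k}, x j‖ₑ ^ q) := by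
    set A := ‖∑ j ∈ t, x j‖ₑ
    set B := ‖∑ j ∈ symmDiff t {k}, x j‖ₑ
    calc _ ≤ (2 * max A B) ^ q := by
          gcongr
          exact (hnorm t).trans <|
            two_mul (max A B) ▸ add_le_add (le_max_left _ _) (le_max_right _ _)
      _ = 2 ^ q * max (A ^ q) (B ^ q) := by
          rw [ENNReal.mul_rpow_of_nonneg _ _ hq, (ENNReal.monotone_rpow_of_nonneg hq).map_max]
      _ ≤ _ := by
          gcongr
          exact max_le_add_of_nonneg zero_le zero_le
  calc _ = ∑ _ ∈ s.powerset, ‖x k‖ₑ ^ q := by rw [Finset.sum_const, nsmul_eq_mul]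
    _ ≤ ∑ t ∈ s.powerset, 2 ^ q * (‖∑ j ∈ t, x j‖ₑ ^ q + ‖∑ j ∈ symmDiff t {k}, x j‖ₑ ^ q) :=
        Finset.sum_le_sum fun t _ => hpair t
    _ = 2 ^ q * (∑ t ∈ s.powerset, ‖∑ j ∈ t, x j‖ₑ ^ q +
          ∑ t ∈ s.powerset, ‖∑ j ∈ t, x j‖ₑ ^ q) := by
        rw [← Finset.mul_sum, Finset.sum_add_distrib]
        congr 2
        exact Finset.sum_nbij' (symmDiff · {k}) (symmDiff · {k}) hmem hmem
          (fun t _ => symmDiff_symmDiff_cancel_right _ _)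
          (fun t _ => symmDiff_symmDiff_cancel_right _ _) fun _ _ => rfl
    _ = _ := by rw [← two_mul, mul_assoc]

theorem IsNormalWeight.cellWeight_ne_zero {v : ℝ → ℝ} {a b : ℝ} (h : IsNormalWeight v a b) {c : ℂ}
    (hc : c ∈ disc) : cellWeight v c ≠ 0 := by
  have hc1 : 0 < 1 - ‖c‖ := sub_pos.2 (mem_disc.1 hc)
  have := h.pos _ (norm_mem_Ico hc)
  exact (ENNReal.ofReal_pos.2 (by positivity)).ne'

theorem cellWeight_ne_top (v : ℝ → ℝ) (c : ℂ) : cellWeight v c ≠ ∞ := ENNReal.ofReal_ne_top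

theorem card_powerset_mul_enorm_rpow_le_kernelSum {s : Finset ℂ} (m : ℕ) (c : ℂ → ℂ) {q : ℝ}
    (hq : 0 ≤ q) (hs : (s : Set ℂ) ⊆ disc) {α z : ℂ} (hα : α ∈ s) (hz : z ∈ disc)
    (hzα : z ∈ whitneyDisc (1 / 20) α) :
    (s.powerset.card : ℝ≥0∞) * ‖c α‖ₑ ^ q ≤
      (3 ^ m) ^ q * (2 ^ q * 2) * ∑ t ∈ s.powerset, ‖kernelSum m t c z‖ₑ ^ q := by
  have hkernel : 1 ≤ 3 * ‖kernel α z‖ₑ := by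
    rw [← ofReal_norm, ← ENNReal.ofReal_ofNat 3, ← ENNReal.ofReal_mul (by norm_num),
      ENNReal.one_le_ofReal]
    linarith [one_third_le_norm_kernel (by norm_num) (hs hα) hz hzα]
  have hterm : ‖c α‖ₑ ≤ 3 ^ m * ‖c α * kernel α z ^ m‖ₑ :=
    calc _ = ‖c α‖ₑ * 1 := (mul_one _).symm
      _ ≤ ‖c α‖ₑ * (3 * ‖kernel α z‖ₑ) ^ m := by
          gcongr
          exact one_le_pow₀ hkernel
      _ = _ := by rw [enorm_mul, enorm_pow, mul_pow, mul_left_comm]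
  calc _ ≤ (s.powerset.card : ℝ≥0∞) * (3 ^ m * ‖c α * kernel α z ^ m‖ₑ) ^ q := by gcongr
    _ = (3 ^ m) ^ q * (s.powerset.card * ‖c α * kernel α z ^ m‖ₑ ^ q) := by
        rw [ENNReal.mul_rpow_of_nonneg _ _ hq, mul_left_comm]
    _ ≤ _ := by
        rw [mul_assoc ((3 ^ m : ℝ≥0∞) ^ q)]
        refine mul_le_mul_right ?_ _
        exact card_powerset_mul_enorm_rpow_le (fun α => c α * kernel α z ^ m) hq hα

theorem IsLattice.exists_testFunctions {u : Set ℂ} (hu : IsLattice u) {v : ℝ → ℝ} {a b : ℝ}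
    (h : IsNormalWeight v a b) {p q : ℝ} (hp : 0 < p) (hq : 0 ≤ q) :
    ∃ C D : ℝ≥0, ∀ s : Finset ℂ, (s : Set ℂ) ⊆ u → ∀ y : ℂ → ℝ≥0∞,
      (∀ α ∈ s, y α ≠ ∞) → ∃ F : Finset ℂ → ℂ → ℂ,
      (∀ t ⊆ s, DifferentiableOn ℂ (F t) disc ∧
        ∫⁻ z, ‖F t z‖ₑ ^ p ∂weightMeasure v ≤ C * ∑ α ∈ s, y α) ∧
      ∀ α ∈ s, ∀ z ∈ whitneyDisc (1 / 20) α,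
        (s.powerset.card : ℝ≥0∞) * (y α / cellWeight v α) ^ (q / p) ≤
          D * ∑ t ∈ s.powerset, ‖F t z‖ₑ ^ q := by
  obtain ⟨m, C, hC⟩ := hu.exists_lintegral_kernelSum_le h hp
  refine ⟨C, (3 ^ m) ^ q * (2 ^ q * 2), fun s hs y hy => ?_⟩
  have hsd := hs.trans hu.subset_disc
  have htop (α : ℂ) (hα : α ∈ s) : y α / cellWeight v α ≠ ∞ :=
    ENNReal.div_ne_top (hy α hα) (h.cellWeight_ne_zero (hsd hα))
  set c : ℂ → ℂ := fun α => (((y α / cellWeight v α) ^ p⁻¹).toReal : ℂ)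
  have hc (α : ℂ) (hα : α ∈ s) : ‖c α‖ₑ = (y α / cellWeight v α) ^ p⁻¹ := by
    rw [← ofReal_norm, Complex.norm_real, Real.norm_of_nonneg ENNReal.toReal_nonneg,
      ENNReal.ofReal_toReal (ENNReal.rpow_ne_top_of_nonneg (by positivity) (htop α hα))]
  refine ⟨fun t => kernelSum m t c, fun t ht => ⟨differentiableOn_kernelSum m
    ((Finset.coe_subset.2 ht).trans hsd) c, ?_⟩, fun α hα z hz => ?_⟩
  · calc _ ≤ C * ∑ α ∈ t, ‖c α‖ₑ ^ p * cellWeight v α := hC t ((Finset.coe_subset.2 ht).trans hs) c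
      _ ≤ C * ∑ α ∈ s, ‖c α‖ₑ ^ p * cellWeight v α := by gcongr
      _ = _ := by
          congr 1
          refine Finset.sum_congr rfl fun α hα => ?_
          rw [hc α hα, ENNReal.rpow_inv_rpow hp.ne',
            ENNReal.div_mul_cancel (h.cellWeight_ne_zero (hsd hα)) (cellWeight_ne_top v α)]
  · rw [div_eq_inv_mul, ENNReal.rpow_mul, ← hc α hα, ENNReal.coe_mul, ENNReal.coe_mul,
      ENNReal.coe_rpow_of_nonneg _ hq, ENNReal.coe_rpow_of_nonneg _ hq]
    exact card_powerset_mul_enorm_rpow_le_kernelSum m c hq hsd hα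
      (whitneyDisc_subset_disc (by norm_num) (hsd hα) hz) hz

theorem prod_rpow_eq_rpow_sum {ι : Type*} (s : Finset ι) (x : ℝ≥0∞) {r : ι → ℝ}
    (hr : ∀ i, 0 ≤ r i) : ∏ i ∈ s, x ^ r i = x ^ ∑ i ∈ s, r i := by
  induction s using Finset.cons_induction with
  | empty => simp
  | cons i s hi ih =>
    rw [Finset.prod_cons, Finset.sum_cons, ih,
      ENNReal.rpow_add_of_nonneg _ _ (hr i) (Finset.sum_nonneg fun j _ => hr j)]

theorem prod_div_rpow {ι : Type*} (s : Finset ι) (x w : ι → ℝ≥0∞) {r : ι → ℝ} (hr : ∀ i, 0 ≤ r i)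
    (hw : ∀ i, w i ≠ ∞) :
    ∏ i ∈ s, (x i / w i) ^ r i = (∏ i ∈ s, x i ^ r i) / ∏ i ∈ s, w i ^ r i := by
  simp_rw [ENNReal.div_rpow_of_nonneg _ _ (hr _)]
  exact ENNReal.prod_div_distrib_of_ne_top fun i _ => ENNReal.rpow_ne_top_of_nonneg (hr i) (hw i)

theorem rpow_sum_prod_rpow_le {ι κ : Type*} [Fintype ι] (s : Finset κ) (X : ι → κ → ℝ≥0∞)
    {r : ι → ℝ} (hr : ∀ i, 0 ≤ r i) (hr0 : 0 < ∑ i, r i) :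
    (∑ k ∈ s, (∏ i, X i k ^ r i) ^ (∑ i, r i)⁻¹) ^ ∑ i, r i ≤ ∏ i, (∑ k ∈ s, X i k) ^ r i := by
  let _ : MeasurableSpace s := ⊤
  have hpow (x : ι → ℝ≥0∞) :
      (∏ i, x i ^ r i) ^ (∑ i, r i)⁻¹ = ∏ i, x i ^ (r i * (∑ i, r i)⁻¹) := by
    rw [← ENNReal.prod_rpow_of_nonneg (inv_nonneg.2 hr0.le)]
    simp_rw [ENNReal.rpow_mul]
  have hholder := ENNReal.lintegral_prod_norm_pow_le (μ := (Measure.count : Measure s)) Finset.univ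
    (f := fun i k => X i k) (fun i _ => measurable_from_top.aemeasurable)
    (by rw [← Finset.sum_mul, mul_inv_cancel₀ hr0.ne'])
    fun i _ => mul_nonneg (hr i) (inv_nonneg.2 hr0.le)
  have hsum (x : κ → ℝ≥0∞) : ∑ k : s, x k = ∑ k ∈ s, x k := Finset.sum_coe_sort s x
  simp only [lintegral_count, tsum_fintype, hsum (X _),
    hsum fun k => ∏ i, X i k ^ (r i * (∑ i, r i)⁻¹)] at hholder
  simp_rw [hpow]
  calc _ ≤ (∏ i, (∑ k ∈ s, X i k) ^ (r i * (∑ i, r i)⁻¹)) ^ ∑ i, r i :=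
        ENNReal.rpow_le_rpow hholder hr0.le
    _ = _ := by rw [← hpow, ENNReal.rpow_inv_rpow hr0.ne']

theorem lpNorm_rpow {p : ℝ} (hp : 0 < p) (μ : Measure ℂ) (f : ℂ → ℂ) (q : ℝ) :
    lpNorm p μ f ^ q = (∫⁻ z in disc, ‖f z‖ₑ ^ p ∂μ) ^ (q / p) := by
  rw [lpNorm, eLpNorm_eq_lintegral_rpow_enorm_toReal (ENNReal.ofReal_pos.2 hp).ne'
    ENNReal.ofReal_ne_top, ENNReal.toReal_ofReal hp.le, ← ENNReal.rpow_mul, one_div_mul_eq_div]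

theorem bergmanNorm_rpow {p : ℝ} (hp : 0 < p) (v : ℝ → ℝ) (f : ℂ → ℂ) (q : ℝ) :
    bergmanNorm p v f ^ q = (∫⁻ z, ‖f z‖ₑ ^ p ∂weightMeasure v) ^ (q / p) := by
  rw [bergmanNorm, lpNorm_rpow hp, restrict_weightMeasure_disc]

theorem bergmanNorm_ne_top_iff {p : ℝ} (hp : 0 < p) (v : ℝ → ℝ) (f : ℂ → ℂ) :
    bergmanNorm p v f ≠ ∞ ↔ ∫⁻ z, ‖f z‖ₑ ^ p ∂weightMeasure v ≠ ∞ := by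
  rw [← ENNReal.rpow_one (lintegral _ _), ← div_self hp.ne', ← bergmanNorm_rpow hp,
    Ne, Ne, ENNReal.rpow_eq_top_iff_of_pos hp]

theorem IsNormalWeight.eqOn_zero_of_bergmanNorm_eq_zero {v : ℝ → ℝ} {a b p : ℝ}
    (h : IsNormalWeight v a b) (hp : 0 < p) {f : ℂ → ℂ} (hf : DifferentiableOn ℂ f disc)
    (hf0 : bergmanNorm p v f = 0) : EqOn f 0 disc := by
  intro c hc
  have hc1 : 0 < 1 - ‖c‖ := sub_pos.2 (mem_disc.1 hc)
  have hint : ∫⁻ z, ‖f z‖ₑ ^ p ∂weightMeasure v = 0 := by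
    rw [← ENNReal.rpow_one (lintegral _ _), ← div_self hp.ne', ← bergmanNorm_rpow hp, hf0,
      ENNReal.zero_rpow_of_pos hp]
  obtain ⟨C, hC⟩ := h.exists_cellWeight_mul_enorm_rpow_le (by norm_num : (0 : ℝ) < 1 / 20)
    (by norm_num) hp
  have hle : cellWeight v c * ‖f c‖ₑ ^ p ≤ 0 :=
    calc _ ≤ C * ∫⁻ w in whitneyDisc (2 * (1 / 20)) c, ‖f w‖ₑ ^ p ∂weightMeasure v :=
          hC f hf c hc c (mem_closedBall_self (by positivity))
      _ ≤ C * 0 := mul_le_mul_right ((setLIntegral_le_lintegral _ _).trans hint.le) _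
      _ = 0 := mul_zero _
  have hzero : ‖f c‖ₑ ^ p = 0 :=
    (mul_eq_zero.1 (nonpos_iff_eq_zero.1 hle)).resolve_left (h.cellWeight_ne_zero hc)
  exact enorm_eq_zero.1 ((ENNReal.rpow_eq_zero_iff_of_pos hp).1 hzero)

section MultiNorm

variable {n : ℕ} {p q : Fin n → ℝ} {v : Fin n → ℝ → ℝ} {a b : Fin n → ℝ} {μ : Measure ℂ}

theorem multiNorm_le {M : ℝ≥0∞}
    (h : ∀ f : Fin n → ℂ → ℂ, (∀ i, f i ∈ bergmanSpace (p i) (v i)) →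
      ∫⁻ z in disc, ∏ i, ‖f i z‖ₑ ^ q i ∂μ ≤ M * ∏ i, bergmanNorm (p i) (v i) (f i) ^ q i) :
    multiNorm p q v μ ≤ M :=
  iSup₂_le fun f hf => ENNReal.div_le_of_le_mul (h f hf)

theorem div_le_multiNorm {f : Fin n → ℂ → ℂ} (hf : ∀ i, f i ∈ bergmanSpace (p i) (v i)) :
    (∫⁻ z in disc, ∏ i, ‖f i z‖ₑ ^ q i ∂μ) / ∏ i, bergmanNorm (p i) (v i) (f i) ^ q i ≤
      multiNorm p q v μ :=
  le_iSup₂_of_le f hf le_rfl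

theorem lintegral_prod_le_multiNorm_mul (hv : ∀ i, IsNormalWeight (v i) (a i) (b i))
    (hp : ∀ i, 0 < p i) (hq : ∀ i, 0 < q i) {f : Fin n → ℂ → ℂ}
    (hf : ∀ i, f i ∈ bergmanSpace (p i) (v i)) :
    ∫⁻ z in disc, ∏ i, ‖f i z‖ₑ ^ q i ∂μ ≤
      multiNorm p q v μ * ∏ i, bergmanNorm (p i) (v i) (f i) ^ q i := by
  by_cases hzero : ∃ i, bergmanNorm (p i) (v i) (f i) = 0
  · obtain ⟨i, hi⟩ := hzero
    have hfi := (hv i).eqOn_zero_of_bergmanNorm_eq_zero (hp i) (hf i).1 hi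
    rw [setLIntegral_congr_fun (g := 0) measurableSet_disc fun z hz =>
      Finset.prod_eq_zero (Finset.mem_univ i) ?_]
    · simp
    · rw [hfi hz, Pi.zero_apply, enorm_zero, ENNReal.zero_rpow_of_pos (hq i)]
  · push Not at hzero
    rw [← ENNReal.div_le_iff
      (Finset.prod_ne_zero_iff.2 fun i _ =>
        (ENNReal.rpow_pos (pos_iff_ne_zero.2 (hzero i)) (hf i).2.ne).ne')
      (ENNReal.prod_ne_top fun i _ => ENNReal.rpow_ne_top_of_nonneg (hq i).le (hf i).2.ne)]
    exact div_le_multiNorm hf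

theorem lintegral_prod_le_of_lintegral_le (hv : ∀ i, IsNormalWeight (v i) (a i) (b i))
    (hp : ∀ i, 0 < p i) (hq : ∀ i, 0 < q i) {f : Fin n → ℂ → ℂ}
    (hf : ∀ i, DifferentiableOn ℂ (f i) disc) {C : Fin n → ℝ≥0} {Y : ℝ≥0∞} (hY : Y ≠ ∞)
    (hfY : ∀ i, ∫⁻ z, ‖f i z‖ₑ ^ p i ∂weightMeasure (v i) ≤ C i * Y) :
    ∫⁻ z in disc, ∏ i, ‖f i z‖ₑ ^ q i ∂μ ≤
      (∏ i, C i ^ (q i / p i) : ℝ≥0) * multiNorm p q v μ * Y ^ totalExponent p q := by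
  have hpq (i : Fin n) : 0 ≤ q i / p i := (div_pos (hq i) (hp i)).le
  have hmem (i : Fin n) : f i ∈ bergmanSpace (p i) (v i) :=
    ⟨hf i, ((bergmanNorm_ne_top_iff (hp i) _ _).2
      (ne_top_of_le_ne_top (ENNReal.mul_ne_top ENNReal.coe_ne_top hY) (hfY i))).lt_top⟩
  calc _ ≤ multiNorm p q v μ * ∏ i, bergmanNorm (p i) (v i) (f i) ^ q i :=
        lintegral_prod_le_multiNorm_mul hv hp hq hmem
    _ ≤ multiNorm p q v μ * ∏ i, ((C i : ℝ≥0∞) * Y) ^ (q i / p i) := by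
        gcongr with i
        rw [bergmanNorm_rpow (hp i)]
        exact ENNReal.rpow_le_rpow (hfY i) (hpq i)
    _ = _ := by
        simp_rw [ENNReal.mul_rpow_of_nonneg _ _ (hpq _), ENNReal.ofNNReal_finsetProd,
          ENNReal.coe_rpow_of_nonneg _ (hpq _)]
        rw [Finset.prod_mul_distrib, prod_rpow_eq_rpow_sum _ _ hpq, ← totalExponent, mul_left_comm,
          mul_assoc]

theorem aemeasurable_prod_enorm_rpow {f : Fin n → ℂ → ℂ} (hf : ∀ i, DifferentiableOn ℂ (f i) disc)
    (q : Fin n → ℝ) (μ : Measure ℂ) :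
    AEMeasurable (fun z => ∏ i, ‖f i z‖ₑ ^ q i) (μ.restrict disc) :=
  Finset.aemeasurable_fun_prod _ fun i _ =>
    ((hf i).continuousOn.aemeasurable measurableSet_disc).enorm.pow_const _

end MultiNorm

section LatticeCarleson

variable {n : ℕ} {p q : Fin n → ℝ} {v : Fin n → ℝ → ℝ} {a b : Fin n → ℝ} {u : Set ℂ}

/-- The joint size `∏ cellWeight (v i) c ^ (q i / p i)` of the Whitney disc at `c` for the weights
`v i`; a multilinear embedding depends on the weights only through it. -/
def jointCellWeight (p q : Fin n → ℝ) (v : Fin n → ℝ → ℝ) (c : ℂ) : ℝ≥0∞ :=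
  ∏ i, cellWeight (v i) c ^ (q i / p i)

/-- The discrete form of the Carleson embedding on a lattice `u`: the sums of `μ(D_c) y_c ^ l / W_c`
over Whitney discs `D_c` are at most `N (∑ y_c) ^ l`. -/
def IsLatticeCarleson (u : Set ℂ) (l : ℝ) (W : ℂ → ℝ≥0∞) (μ : Measure ℂ) (N : ℝ≥0∞) : Prop :=
  ∀ s : Finset ℂ, (s : Set ℂ) ⊆ u → ∀ y : ℂ → ℝ≥0∞, (∀ c ∈ s, y c ≠ ∞) →
    ∑ c ∈ s, μ (whitneyDisc (1 / 20) c) * (y c ^ l / W c) ≤ N * (∑ c ∈ s, y c) ^ l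

theorem IsLattice.exists_sum_measure_whitneyDisc_mul_le (hu : IsLattice u) :
    ∃ N : ℝ≥0, ∀ (μ : Measure ℂ) (g : ℂ → ℝ≥0∞), AEMeasurable g (μ.restrict disc) →
      ∀ s : Finset ℂ, (s : Set ℂ) ⊆ u → ∀ x : ℂ → ℝ≥0∞,
        (∀ c ∈ s, ∀ z ∈ whitneyDisc (1 / 20) c, x c ≤ g z) →
          ∑ c ∈ s, μ (whitneyDisc (1 / 20) c) * x c ≤ N * ∫⁻ z in disc, g z ∂μ := by
  obtain ⟨N, hN⟩ := hu.exists_sum_setLIntegral_whitneyDisc_le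
  refine ⟨N, fun μ g hg s hs x hx => (Finset.sum_le_sum fun c hc => ?_).trans (hN μ g hg s hs)⟩
  have hc1 : 0 < 1 - ‖c‖ := sub_pos.2 (mem_disc.1 (hu.subset_disc (hs hc)))
  calc _ = ∫⁻ _ in whitneyDisc (1 / 20) c, x c ∂μ := by rw [setLIntegral_const, mul_comm]
    _ ≤ ∫⁻ z in whitneyDisc (1 / 20) c, g z ∂μ :=
        setLIntegral_mono' (measurableSet_whitneyDisc _ _) (hx c hc)
    _ ≤ _ := lintegral_mono_set (closedBall_subset_closedBall (by linarith))

theorem IsLattice.lintegral_disc_le (hu : IsLattice u) {μ : Measure ℂ} {g : ℂ → ℝ≥0∞} {B : ℝ≥0∞}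
    (h : ∀ s : Finset ℂ, (s : Set ℂ) ⊆ u → ∑ c ∈ s, ∫⁻ z in whitneyDisc (1 / 20) c, g z ∂μ ≤ B) :
    ∫⁻ z in disc, g z ∂μ ≤ B := by
  have : Countable u := hu.countable.to_subtype
  have hcover : disc ⊆ ⋃ c : u, whitneyDisc (1 / 20) (c : ℂ) := fun z hz => by
    obtain ⟨c, hc, hzc⟩ := hu.exists_mem_whitneyDisc z hz
    exact mem_iUnion.2 ⟨⟨c, hc⟩, hzc⟩
  calc _ ≤ ∑' c : u, ∫⁻ z in whitneyDisc (1 / 20) (c : ℂ), g z ∂μ :=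
        (lintegral_mono_set hcover).trans (lintegral_iUnion_le _ _)
    _ ≤ B := by
        rw [ENNReal.tsum_eq_iSup_sum]
        refine iSup_le fun t => ?_
        have ht := h (t.map (Function.Embedding.subtype _)) (by simp)
        rwa [Finset.sum_map] at ht

theorem jointCellWeight_ne_top (hpq : ∀ i, 0 ≤ q i / p i) (c : ℂ) :
    jointCellWeight p q v c ≠ ∞ :=
  ENNReal.prod_ne_top fun i _ => ENNReal.rpow_ne_top_of_nonneg (hpq i) (cellWeight_ne_top _ _)

theorem jointCellWeight_ne_zero (hv : ∀ i, IsNormalWeight (v i) (a i) (b i)) {c : ℂ}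
    (hc : c ∈ disc) : jointCellWeight p q v c ≠ 0 :=
  Finset.prod_ne_zero_iff.2 fun i _ => (ENNReal.rpow_pos
    (pos_iff_ne_zero.2 ((hv i).cellWeight_ne_zero hc)) (cellWeight_ne_top _ _)).ne'

theorem prod_div_cellWeight_rpow (hpq : ∀ i, 0 ≤ q i / p i) (x : ℝ≥0∞) (c : ℂ) :
    ∏ i, (x / cellWeight (v i) c) ^ (q i / p i) =
      x ^ totalExponent p q / jointCellWeight p q v c := by
  rw [prod_div_rpow _ _ _ hpq fun i => cellWeight_ne_top _ _, prod_rpow_eq_rpow_sum _ _ hpq,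
    totalExponent, jointCellWeight]

theorem IsLattice.exists_lintegral_majorant_le (hu : IsLattice u)
    (hv : ∀ i, IsNormalWeight (v i) (a i) (b i)) (hp : ∀ i, 0 < p i) (hq : ∀ i, 0 < q i) :
    ∃ C : ℝ≥0, ∀ (μ : Measure ℂ) (s : Finset ℂ), (s : Set ℂ) ⊆ u → ∀ y : ℂ → ℝ≥0∞,
      (∀ c ∈ s, y c ≠ ∞) → ∃ G : ℂ → ℝ≥0∞, AEMeasurable G (μ.restrict disc) ∧
        (∀ c ∈ s, ∀ z ∈ whitneyDisc (1 / 20) c,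
          y c ^ totalExponent p q / jointCellWeight p q v c ≤ G z) ∧
        ∫⁻ z in disc, G z ∂μ ≤ C * multiNorm p q v μ * (∑ c ∈ s, y c) ^ totalExponent p q := by
  have hpq (i : Fin n) : 0 ≤ q i / p i := (div_pos (hq i) (hp i)).le
  choose C D hCD using fun i => hu.exists_testFunctions (hv i) (hp i) (hq i).le
  refine ⟨(∏ i, D i) * ∏ i, C i ^ (q i / p i), fun μ s hs y hy => ?_⟩
  choose F hF hlower using fun i => hCD i s hs y hy
  set T := Fintype.piFinset fun _ : Fin n => s.powerset with hT
  set κ : ℝ≥0∞ := ∏ _ : Fin n, (s.powerset.card : ℝ≥0∞)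
  have hκ0 : κ ≠ 0 := Finset.prod_ne_zero_iff.2 fun i _ => by simp
  have hκt : κ ≠ ∞ := ENNReal.prod_ne_top fun i _ => ENNReal.natCast_ne_top _
  have hFT (t : Fin n → Finset ℂ) (ht : t ∈ T) (i : Fin n) :=
    hF i (t i) (Finset.mem_powerset.1 (Fintype.mem_piFinset.1 ht i))
  have hmeas (t : Fin n → Finset ℂ) (ht : t ∈ T) :=
    aemeasurable_prod_enorm_rpow (fun i => (hFT t ht i).1) q μ
  refine ⟨fun z => κ⁻¹ * (∏ i, D i : ℝ≥0) * ∑ t ∈ T, ∏ i, ‖F i (t i) z‖ₑ ^ q i,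
    (Finset.aemeasurable_fun_sum _ hmeas).const_mul _, fun c hc z hz => ?_, ?_⟩
  · beta_reduce
    rw [mul_assoc, ← ENNReal.div_eq_inv_mul, ENNReal.le_div_iff_mul_le (.inl hκ0) (.inl hκt),
      mul_comm,
      ← prod_div_cellWeight_rpow hpq, hT,
      ← Finset.prod_univ_sum (fun _ => s.powerset) fun i t => ‖F i t z‖ₑ ^ q i,
      ENNReal.ofNNReal_finsetProd, ← Finset.prod_mul_distrib, ← Finset.prod_mul_distrib]
    exact Finset.prod_le_prod' fun i _ => hlower i c hc z hz
  · rw [lintegral_const_mul' _ _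
      (ENNReal.mul_ne_top (ENNReal.inv_ne_top.2 hκ0) ENNReal.coe_ne_top),
      lintegral_finsetSum' _ hmeas]
    calc _ ≤ κ⁻¹ * (∏ i, D i : ℝ≥0) * (T.card • ((∏ i, C i ^ (q i / p i) : ℝ≥0) *
            multiNorm p q v μ * (∑ c ∈ s, y c) ^ totalExponent p q)) :=
          mul_le_mul_right (Finset.sum_le_card_nsmul _ _ _ fun t ht =>
            lintegral_prod_le_of_lintegral_le hv hp hq (fun i => (hFT t ht i).1)
              (ENNReal.sum_ne_top.2 hy) fun i => (hFT t ht i).2) _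
      _ = κ⁻¹ * κ * (((∏ i, D i : ℝ≥0) * (∏ i, C i ^ (q i / p i) : ℝ≥0)) *
            multiNorm p q v μ * (∑ c ∈ s, y c) ^ totalExponent p q) := by
          rw [nsmul_eq_mul, Fintype.card_piFinset, Nat.cast_prod]
          ring
      _ = _ := by rw [ENNReal.inv_mul_cancel hκ0 hκt, one_mul, ENNReal.coe_mul]

theorem IsLattice.exists_isLatticeCarleson (hu : IsLattice u)
    (hv : ∀ i, IsNormalWeight (v i) (a i) (b i)) (hp : ∀ i, 0 < p i) (hq : ∀ i, 0 < q i) :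
    ∃ C : ℝ≥0, ∀ μ : Measure ℂ, IsLatticeCarleson u (totalExponent p q) (jointCellWeight p q v) μ
      (C * multiNorm p q v μ) := by
  obtain ⟨C, hC⟩ := hu.exists_lintegral_majorant_le hv hp hq
  obtain ⟨N, hN⟩ := hu.exists_sum_measure_whitneyDisc_mul_le
  refine ⟨N * C, fun μ s hs y hy => ?_⟩
  obtain ⟨G, hG, hle, hint⟩ := hC μ s hs y hy
  calc _ ≤ N * ∫⁻ z in disc, G z ∂μ := hN μ G hG s hs _ hle
    _ ≤ N * (C * multiNorm p q v μ * (∑ c ∈ s, y c) ^ totalExponent p q) :=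
        mul_le_mul_right hint _
    _ = _ := by
        rw [ENNReal.coe_mul]
        ring

/-- The integral `∫ |f|^p v dA` over the enlarged Whitney disc at `c`, which controls `|f|^p` on the
Whitney disc of the lattice itself. -/
def localIntegral (p : ℝ) (v : ℝ → ℝ) (f : ℂ → ℂ) (c : ℂ) : ℝ≥0∞ :=
  ∫⁻ w in whitneyDisc (1 / 10) c, ‖f w‖ₑ ^ p ∂weightMeasure v

theorem localIntegral_ne_top {p : ℝ} (hp : 0 < p) {v : ℝ → ℝ} {f : ℂ → ℂ}
    (hf : bergmanNorm p v f ≠ ∞) (c : ℂ) : localIntegral p v f c ≠ ∞ :=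
  ne_top_of_le_ne_top ((bergmanNorm_ne_top_iff hp _ _).1 hf) (setLIntegral_le_lintegral _ _)

theorem exists_prod_enorm_rpow_le (hv : ∀ i, IsNormalWeight (v i) (a i) (b i))
    (hp : ∀ i, 0 < p i) (hq : ∀ i, 0 ≤ q i) :
    ∃ C : ℝ≥0, ∀ f : Fin n → ℂ → ℂ, (∀ i, DifferentiableOn ℂ (f i) disc) →
      ∀ c ∈ disc, ∀ z ∈ whitneyDisc (1 / 20) c, ∏ i, ‖f i z‖ₑ ^ q i ≤
        C * ((∏ i, localIntegral (p i) (v i) (f i) c ^ (q i / p i)) /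
          jointCellWeight p q v c) := by
  have hpq (i : Fin n) : 0 ≤ q i / p i := div_nonneg (hq i) (hp i).le
  choose C hC using fun i => (hv i).exists_cellWeight_mul_enorm_rpow_le
    (by norm_num : (0 : ℝ) < 1 / 20) (by norm_num) (hp i)
  refine ⟨∏ i, C i ^ (q i / p i), fun f hf c hc z hz => ?_⟩
  rw [← mul_div_assoc, ENNReal.le_div_iff_mul_le (.inl (jointCellWeight_ne_zero hv hc))
    (.inl (jointCellWeight_ne_top hpq c)), jointCellWeight, ENNReal.ofNNReal_finsetProd,
    ← Finset.prod_mul_distrib, ← Finset.prod_mul_distrib]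
  refine Finset.prod_le_prod' fun i _ => ?_
  have hlocal := ENNReal.rpow_le_rpow (hC i (f i) (hf i) c hc z hz) (hpq i)
  rwa [ENNReal.mul_rpow_of_nonneg _ _ (hpq i), ENNReal.mul_rpow_of_nonneg _ _ (hpq i),
    ← ENNReal.rpow_mul, mul_div_cancel₀ _ (hp i).ne', ← ENNReal.coe_rpow_of_nonneg _ (hpq i),
    mul_comm, show (2 : ℝ) * (1 / 20) = 1 / 10 by norm_num] at hlocal

theorem IsLattice.exists_sum_localIntegral_le (hu : IsLattice u) :
    ∃ A : ℝ≥0, ∀ (p : ℝ) (v : ℝ → ℝ) (f : ℂ → ℂ), DifferentiableOn ℂ f disc →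
      ∀ s : Finset ℂ, (s : Set ℂ) ⊆ u →
        ∑ c ∈ s, localIntegral p v f c ≤ A * ∫⁻ z, ‖f z‖ₑ ^ p ∂weightMeasure v := by
  obtain ⟨A, hA⟩ := hu.exists_sum_setLIntegral_whitneyDisc_le
  refine ⟨A, fun p v f hf s hs => ?_⟩
  have h := hA (weightMeasure v) (fun w => ‖f w‖ₑ ^ p)
    ((hf.continuousOn.aemeasurable measurableSet_disc).enorm.pow_const _) s hs
  rwa [restrict_weightMeasure_disc] at h

theorem IsLattice.exists_rpow_sum_prod_localIntegral_le (hu : IsLattice u) (hp : ∀ i, 0 < p i)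
    (hq : ∀ i, 0 ≤ q i) (hl : 0 < totalExponent p q) :
    ∃ A : ℝ≥0, ∀ (v : Fin n → ℝ → ℝ) (f : Fin n → ℂ → ℂ), (∀ i, DifferentiableOn ℂ (f i) disc) →
      ∀ s : Finset ℂ, (s : Set ℂ) ⊆ u →
        (∑ c ∈ s, (∏ i, localIntegral (p i) (v i) (f i) c ^ (q i / p i)) ^ (totalExponent p q)⁻¹) ^
          totalExponent p q ≤ A * ∏ i, bergmanNorm (p i) (v i) (f i) ^ q i := by
  have hpq (i : Fin n) : 0 ≤ q i / p i := div_nonneg (hq i) (hp i).le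
  obtain ⟨A, hA⟩ := hu.exists_sum_localIntegral_le
  refine ⟨∏ i, A ^ (q i / p i), fun v f hf s hs => ?_⟩
  calc _ ≤ ∏ i, (∑ c ∈ s, localIntegral (p i) (v i) (f i) c) ^ (q i / p i) :=
        rpow_sum_prod_rpow_le s _ hpq hl
    _ ≤ ∏ i, (A * ∫⁻ z, ‖f i z‖ₑ ^ p i ∂weightMeasure (v i)) ^ (q i / p i) :=
        Finset.prod_le_prod' fun i _ =>
          ENNReal.rpow_le_rpow (hA (p i) (v i) (f i) (hf i) s hs) (hpq i)
    _ = _ := by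
        simp_rw [bergmanNorm_rpow (hp _), ENNReal.mul_rpow_of_nonneg _ _ (hpq _),
          Finset.prod_mul_distrib, ENNReal.ofNNReal_finsetProd,
          ENNReal.coe_rpow_of_nonneg _ (hpq _)]

theorem IsLatticeCarleson.exists_multiNorm_le (hu : IsLattice u)
    (hv : ∀ i, IsNormalWeight (v i) (a i) (b i)) (hp : ∀ i, 0 < p i) (hq : ∀ i, 0 ≤ q i)
    (hl : 0 < totalExponent p q) :
    ∃ C : ℝ≥0, ∀ (μ : Measure ℂ) (N : ℝ≥0∞),
      IsLatticeCarleson u (totalExponent p q) (jointCellWeight p q v) μ N →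
        multiNorm p q v μ ≤ C * N := by
  have hpq (i : Fin n) : 0 ≤ q i / p i := div_nonneg (hq i) (hp i).le
  obtain ⟨C, hC⟩ := exists_prod_enorm_rpow_le hv hp hq
  obtain ⟨A, hA⟩ := hu.exists_rpow_sum_prod_localIntegral_le hp hq hl
  refine ⟨C * A, fun μ N hN => multiNorm_le fun f hf => hu.lintegral_disc_le fun s hs => ?_⟩
  set y : ℂ → ℝ≥0∞ := fun c =>
    (∏ i, localIntegral (p i) (v i) (f i) c ^ (q i / p i)) ^ (totalExponent p q)⁻¹ with hy
  have hy_top (c : ℂ) : y c ≠ ∞ :=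
    ENNReal.rpow_ne_top_of_nonneg (inv_nonneg.2 hl.le) <| ENNReal.prod_ne_top fun i _ =>
      ENNReal.rpow_ne_top_of_nonneg (hpq i) (localIntegral_ne_top (hp i) (hf i).2.ne c)
  have hpoint (c : ℂ) (hc : c ∈ s) (z : ℂ) (hz : z ∈ whitneyDisc (1 / 20) c) :
      ∏ i, ‖f i z‖ₑ ^ q i ≤ C * (y c ^ totalExponent p q / jointCellWeight p q v c) := by
    rw [hy, ENNReal.rpow_inv_rpow hl.ne']
    exact hC f (fun i => (hf i).1) c (hu.subset_disc (hs hc)) z hz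
  calc ∑ c ∈ s, ∫⁻ z in whitneyDisc (1 / 20) c, ∏ i, ‖f i z‖ₑ ^ q i ∂μ
      ≤ ∑ c ∈ s, ∫⁻ _ in whitneyDisc (1 / 20) c, C *
          (y c ^ totalExponent p q / jointCellWeight p q v c) ∂μ :=
        Finset.sum_le_sum fun c hc =>
          setLIntegral_mono' (measurableSet_whitneyDisc _ _) (hpoint c hc)
    _ = C * ∑ c ∈ s, μ (whitneyDisc (1 / 20) c) *
          (y c ^ totalExponent p q / jointCellWeight p q v c) := by
        simp_rw [setLIntegral_const, Finset.mul_sum, mul_assoc, mul_comm (_ / _ : ℝ≥0∞)]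
    _ ≤ C * (N * (∑ c ∈ s, y c) ^ totalExponent p q) :=
        mul_le_mul_right (hN s hs y fun c _ => hy_top c) _
    _ ≤ C * (N * (A * ∏ i, bergmanNorm (p i) (v i) (f i) ^ q i)) :=
        mul_le_mul_right (mul_le_mul_right (hA v f (fun i => (hf i).1) s hs) _) _
    _ = _ := by
        rw [ENNReal.coe_mul]
        ring

end LatticeCarleson

section RegularWeight

variable {ω : ℝ → ℝ}

theorem IsRadialWeight.intervalIntegrable (h : IsRadialWeight ω) :
    IntervalIntegrable ω volume 0 1 :=
  (intervalIntegrable_iff_integrableOn_Ico_of_le zero_le_one).2 h.integrable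

theorem tail_eq_neg_integral (ω : ℝ → ℝ) : tail ω = -fun r => ∫ t in (1 : ℝ)..r, ω t :=
  funext fun r => intervalIntegral.integral_symm 1 r

theorem IsRadialWeight.absolutelyContinuousOnInterval_tail (h : IsRadialWeight ω) :
    AbsolutelyContinuousOnInterval (tail ω) 0 1 := by
  rw [tail_eq_neg_integral]
  exact (h.intervalIntegrable.absolutelyContinuousOnInterval_intervalIntegral right_mem_uIcc).neg

theorem IsRadialWeight.ae_hasDerivAt_tail (h : IsRadialWeight ω) :
    ∀ᵐ t, t ∈ uIcc (0 : ℝ) 1 → HasDerivAt (tail ω) (-ω t) t := by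
  filter_upwards [h.intervalIntegrable.ae_hasDerivAt_integral] with t ht hmem
  rw [tail_eq_neg_integral]
  exact (ht hmem 1 right_mem_uIcc).neg

theorem IsRadialWeight.integral_rpow_mul_tail_sub (h : IsRadialWeight ω) (e : ℝ) {r s : ℝ}
    (hr : r ∈ Ico (0 : ℝ) 1) (hs : s ∈ Ico (0 : ℝ) 1) :
    ∫ t in r..s, (1 - t) ^ (-e - 1) * (e * tail ω t - (1 - t) * ω t) =
      (1 - s) ^ (-e) * tail ω s - (1 - r) ^ (-e) * tail ω r := by
  have hsub : uIcc r s ⊆ Ico 0 1 := ordConnected_Ico.uIcc_subset hr hs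
  have hsub' : uIcc r s ⊆ uIcc 0 1 := by
    rw [uIcc_of_le (zero_le_one' ℝ)]
    exact hsub.trans Ico_subset_Icc_self
  have hpow : AbsolutelyContinuousOnInterval (fun t : ℝ => (1 - t) ^ (-e)) r s :=
    ContDiffOn.absolutelyContinuousOnInterval
      ((contDiffOn_const.sub contDiffOn_id).rpow_const_of_ne fun t ht =>
        (sub_pos.2 (hsub ht).2).ne')
  rw [← hpow.integral_deriv_mul_eq_sub (h.absolutelyContinuousOnInterval_tail.mono hsub')]
  refine intervalIntegral.integral_congr_ae ?_
  filter_upwards [h.ae_hasDerivAt_tail] with t ht htrs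
  have htrs' := uIoc_subset_uIcc htrs
  have ht1 : 0 < 1 - t := sub_pos.2 (hsub htrs').2
  have hderiv : HasDerivAt (fun t : ℝ => (1 - t) ^ (-e)) (-1 * -e * (1 - t) ^ (-e - 1)) t :=
    ((hasDerivAt_id t).const_sub 1).rpow_const (Or.inl ht1.ne')
  have hpow_succ : (1 - t) ^ (-e) = (1 - t) ^ (-e - 1) * (1 - t) := by
    rw [← Real.rpow_add_one ht1.ne', sub_add_cancel]
  rw [(ht (hsub' htrs')).deriv, hderiv.deriv, hpow_succ]
  ring

theorem IsRadialWeight.antitoneOn_rpow_mul_tail (h : IsRadialWeight ω) {e : ℝ}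
    (he : ∀ t ∈ Ico (0 : ℝ) 1, e * tail ω t ≤ (1 - t) * ω t) :
    AntitoneOn (fun r => (1 - r) ^ (-e) * tail ω r) (Ico 0 1) := by
  intro r hr s hs hrs
  rw [← sub_nonneg, ← h.integral_rpow_mul_tail_sub e hs hr, intervalIntegral.integral_symm,
    ← intervalIntegral.integral_neg]
  refine intervalIntegral.integral_nonneg hrs fun t ht => neg_nonneg.2 ?_
  have ht' : t ∈ Ico (0 : ℝ) 1 := ordConnected_Ico.out hr hs ht
  exact mul_nonpos_of_nonneg_of_nonpos (Real.rpow_nonneg (sub_pos.2 ht'.2).le _)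
    (sub_nonpos.2 (he t ht'))

theorem IsRadialWeight.monotoneOn_rpow_mul_tail (h : IsRadialWeight ω) {e : ℝ}
    (he : ∀ t ∈ Ico (0 : ℝ) 1, (1 - t) * ω t ≤ e * tail ω t) :
    MonotoneOn (fun r => (1 - r) ^ (-e) * tail ω r) (Ico 0 1) := by
  intro r hr s hs hrs
  rw [← sub_nonneg, ← h.integral_rpow_mul_tail_sub e hr hs]
  refine intervalIntegral.integral_nonneg hrs fun t ht => ?_
  have ht' : t ∈ Ico (0 : ℝ) 1 := ordConnected_Ico.out hr hs ht
  exact mul_nonneg (Real.rpow_nonneg (sub_pos.2 ht'.2).le _) (sub_nonneg.2 (he t ht'))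

/-- Two weights are equivalent if each is bounded by a multiple of the other on `[0, 1)`; they then
have the same Bergman spaces, with equivalent norms. -/
def WeightEquiv (ω v : ℝ → ℝ) : Prop :=
  ∃ K : ℝ≥0, 0 < K ∧ ∀ r ∈ Ico (0 : ℝ) 1, ω r ≤ K * v r ∧ v r ≤ K * ω r

theorem WeightEquiv.prod_rpow {ι : Type*} [Fintype ι] {ω v : ι → ℝ → ℝ} {θ : ι → ℝ}
    (h : ∀ i, WeightEquiv (ω i) (v i)) (hω : ∀ i, ∀ r ∈ Ico (0 : ℝ) 1, 0 ≤ ω i r)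
    (hv : ∀ i, ∀ r ∈ Ico (0 : ℝ) 1, 0 ≤ v i r) (hθ : ∀ i, 0 ≤ θ i) :
    WeightEquiv (fun r => ∏ i, ω i r ^ θ i) (fun r => ∏ i, v i r ^ θ i) := by
  choose K hK hωv using h
  have hle {x y : ι → ℝ} (hx : ∀ i, 0 ≤ x i) (hy : ∀ i, 0 ≤ y i) (hxy : ∀ i, x i ≤ K i * y i) :
      ∏ i, x i ^ θ i ≤ (∏ i, K i ^ θ i : ℝ≥0) * ∏ i, y i ^ θ i := by
    rw [NNReal.coe_prod, ← Finset.prod_mul_distrib]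
    refine Finset.prod_le_prod (fun i _ => Real.rpow_nonneg (hx i) _) fun i _ => ?_
    rw [NNReal.coe_rpow, ← Real.mul_rpow (K i).coe_nonneg (hy i)]
    exact Real.rpow_le_rpow (hx i) (hxy i) (hθ i)
  exact ⟨∏ i, K i ^ θ i, Finset.prod_pos fun i _ => NNReal.rpow_pos (hK i), fun r hr =>
    ⟨hle (fun i => hω i r hr) (fun i => hv i r hr) fun i => (hωv i r hr).1,
      hle (fun i => hv i r hr) (fun i => hω i r hr) fun i => (hωv i r hr).2⟩⟩

/-- The average `tail ω r / (1 - r)` of a weight over `[r, 1)`; for a regular weight it is an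
equivalent weight with better pointwise behaviour. It is set to `0` off `[0, 1)` to make it
measurable. -/
def tailAverage (ω : ℝ → ℝ) : ℝ → ℝ := (Ico (0 : ℝ) 1).indicator fun r => tail ω r / (1 - r)

theorem tailAverage_of_mem {r : ℝ} (hr : r ∈ Ico (0 : ℝ) 1) :
    tailAverage ω r = tail ω r / (1 - r) :=
  indicator_of_mem hr _

theorem IsRadialWeight.measurable_tailAverage (h : IsRadialWeight ω) :
    Measurable (tailAverage ω) := by
  classical
  have htail : ContinuousOn (tail ω) (Ico 0 1) :=
    h.absolutelyContinuousOnInterval_tail.continuousOn.mono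
      (Ico_subset_Icc_self.trans Icc_subset_uIcc)
  rw [tailAverage, ← piecewise_eq_indicator]
  exact (htail.div (by fun_prop) fun r hr => (sub_pos.2 hr.2).ne').measurable_piecewise
    continuousOn_const measurableSet_Ico

theorem rpow_mul_tail_eq_rpow_mul_tailAverage (ω : ℝ → ℝ) (e : ℝ) :
    EqOn (fun r => (1 - r) ^ (-e) * tail ω r) (fun r => (1 - r) ^ (1 - e) * tailAverage ω r)
      (Ico 0 1) := by
  intro r hr
  have hr1 : 1 - r ≠ 0 := (sub_pos.2 hr.2).ne'
  beta_reduce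
  rw [tailAverage_of_mem hr, sub_eq_neg_add 1 e, Real.rpow_add_one hr1]
  field_simp

theorem IsRegularWeight.exists_isNormalWeight (h : IsRegularWeight ω) :
    ∃ (v : ℝ → ℝ) (a b : ℝ), IsNormalWeight v a b ∧ WeightEquiv ω v := by
  obtain ⟨c, C, hc, hcC⟩ := h.comparable
  have hC : 0 < C := hc.trans_le ((hcC 0 (by simp)).1.trans (hcC 0 (by simp)).2)
  have hden (r : ℝ) (hr : r ∈ Ico (0 : ℝ) 1) : 0 < (1 - r) * ω r :=
    mul_pos (sub_pos.2 hr.2) (h.pos r hr)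
  have hlower (r : ℝ) (hr : r ∈ Ico (0 : ℝ) 1) : (1 - r) * ω r ≤ c⁻¹ * tail ω r := by
    rw [le_inv_mul_iff₀ hc]
    exact (le_div_iff₀ (hden r hr)).1 (hcC r hr).1
  have hupper (r : ℝ) (hr : r ∈ Ico (0 : ℝ) 1) : C⁻¹ * tail ω r ≤ (1 - r) * ω r := by
    rw [inv_mul_le_iff₀ hC]
    exact (div_le_iff₀ (hden r hr)).1 (hcC r hr).2
  have htail (r : ℝ) (hr : r ∈ Ico (0 : ℝ) 1) : 0 < tail ω r :=
    pos_of_mul_pos_right ((hden r hr).trans_le (hlower r hr)) (inv_pos.2 hc).le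
  have hpos (r : ℝ) (hr : r ∈ Ico (0 : ℝ) 1) : 0 < tailAverage ω r := by
    rw [tailAverage_of_mem hr]
    exact div_pos (htail r hr) (sub_pos.2 hr.2)
  refine ⟨tailAverage ω, C⁻¹, c⁻¹, ⟨h.measurable_tailAverage, hpos, inv_pos.2 hC, ?_, ?_⟩, ?_⟩
  · exact (h.antitoneOn_rpow_mul_tail hupper).congr (rpow_mul_tail_eq_rpow_mul_tailAverage ω _)
  · exact (h.monotoneOn_rpow_mul_tail hlower).congr (rpow_mul_tail_eq_rpow_mul_tailAverage ω _)
  · refine ⟨⟨max c⁻¹ C, by positivity⟩, lt_max_of_lt_right hC, fun r hr => ⟨?_, ?_⟩⟩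
    · refine le_trans ?_ (mul_le_mul_of_nonneg_right (le_max_left _ _) (hpos r hr).le)
      rw [tailAverage_of_mem hr, ← mul_div_assoc, le_div_iff₀ (sub_pos.2 hr.2), mul_comm]
      exact hlower r hr
    · refine le_trans ?_ (mul_le_mul_of_nonneg_right (le_max_right _ _) (h.pos r hr).le)
      rw [tailAverage_of_mem hr, div_le_iff₀ (sub_pos.2 hr.2), mul_assoc, ← inv_mul_le_iff₀ hC,
        mul_comm (ω r)]
      exact hupper r hr

end RegularWeight

section Dominated

variable {α : Type*} {F G H : α → ℝ≥0∞}

/-- The relation `F ≲ G`: an inequality up to a finite constant, uniform in the argument. The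
argument is the measure `μ` throughout. -/
def Dominated (F G : α → ℝ≥0∞) : Prop := ∃ C : ℝ≥0, ∀ a, F a ≤ C * G a

theorem Dominated.trans (hFG : Dominated F G) (hGH : Dominated G H) : Dominated F H := by
  obtain ⟨C, hC⟩ := hFG
  obtain ⟨D, hD⟩ := hGH
  refine ⟨C * D, fun a => (hC a).trans ?_⟩
  rw [ENNReal.coe_mul, mul_assoc]
  exact mul_le_mul_right (hD a) _

theorem Dominated.lt_top (h : Dominated F G) {a : α} (ha : G a < ∞) : F a < ∞ :=
  (h.choose_spec a).trans_lt (ENNReal.mul_lt_top ENNReal.coe_lt_top ha)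

theorem Dominated.exists_pos_forall_le (hFG : Dominated F G) (hGF : Dominated G F) :
    ∃ C : ℝ≥0, 0 < C ∧ ∀ a, F a ≤ C * G a ∧ G a ≤ C * F a := by
  obtain ⟨C, hC⟩ := hFG
  obtain ⟨D, hD⟩ := hGF
  refine ⟨max (max C D) 1, by positivity, fun a => ⟨(hC a).trans ?_, (hD a).trans ?_⟩⟩ <;>
    gcongr <;> simp

end Dominated

section WeightComparison

variable {ω v : ℝ → ℝ} {p q : ℝ}

theorem WeightEquiv.symm (h : WeightEquiv ω v) : WeightEquiv v ω := by
  obtain ⟨K, hK, hle⟩ := h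
  exact ⟨K, hK, fun r hr => (hle r hr).symm⟩

theorem weightMeasure_le_smul {K : ℝ≥0} (h : ∀ r ∈ Ico (0 : ℝ) 1, ω r ≤ K * v r) :
    weightMeasure ω ≤ (K : ℝ≥0∞) • weightMeasure v := by
  rw [weightMeasure, weightMeasure, ← withDensity_smul' _ _ ENNReal.coe_ne_top]
  refine withDensity_mono ?_
  filter_upwards [Measure.ae_smul_measure (ae_restrict_mem measurableSet_disc) _] with z hz
  rw [Pi.smul_apply, smul_eq_mul, ← ENNReal.ofReal_coe_nnreal,
    ← ENNReal.ofReal_mul K.coe_nonneg]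
  exact ENNReal.ofReal_le_ofReal (h _ (norm_mem_Ico hz))

theorem WeightEquiv.exists_bergmanNorm_rpow_le (h : WeightEquiv ω v) (hp : 0 < p) (hq : 0 ≤ q) :
    ∃ K : ℝ≥0, 0 < K ∧ ∀ f, bergmanNorm p ω f ^ q ≤ K * bergmanNorm p v f ^ q := by
  obtain ⟨K, hK, hle⟩ := h
  have hqp : 0 ≤ q / p := div_nonneg hq hp.le
  refine ⟨K ^ (q / p), NNReal.rpow_pos hK, fun f => ?_⟩
  rw [bergmanNorm_rpow hp, bergmanNorm_rpow hp, ENNReal.coe_rpow_of_nonneg _ hqp,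
    ← ENNReal.mul_rpow_of_nonneg _ _ hqp, ← smul_eq_mul, ← lintegral_smul_measure]
  exact ENNReal.rpow_le_rpow
    (lintegral_mono' (weightMeasure_le_smul fun r hr => (hle r hr).1) le_rfl) hqp

theorem WeightEquiv.bergmanSpace_subset (h : WeightEquiv ω v) (hp : 0 < p) :
    bergmanSpace p v ⊆ bergmanSpace p ω := by
  obtain ⟨K, -, hK⟩ := h.exists_bergmanNorm_rpow_le hp zero_le_one
  simp only [ENNReal.rpow_one] at hK
  exact fun f hf => ⟨hf.1, (hK f).trans_lt (ENNReal.mul_lt_top ENNReal.coe_lt_top hf.2)⟩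

theorem multiNorm_dominated_of_weightEquiv {n : ℕ} {p q : Fin n → ℝ} {ω v : Fin n → ℝ → ℝ}
    (h : ∀ i, WeightEquiv (ω i) (v i)) (hp : ∀ i, 0 < p i) (hq : ∀ i, 0 ≤ q i) :
    Dominated (multiNorm p q ω) (multiNorm p q v) := by
  choose K hK hKle using fun i => (h i).symm.exists_bergmanNorm_rpow_le (hp i) (hq i)
  have hK0 : ((∏ i, K i : ℝ≥0) : ℝ≥0∞) ≠ 0 :=
    ENNReal.coe_ne_zero.2 (Finset.prod_pos fun i _ => hK i).ne'
  refine ⟨∏ i, K i, fun μ => iSup₂_le fun f hf => ?_⟩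
  have hfv (i : Fin n) : f i ∈ bergmanSpace (p i) (v i) :=
    (h i).symm.bergmanSpace_subset (hp i) (hf i)
  have hnorm : ∏ i, bergmanNorm (p i) (v i) (f i) ^ q i ≤
      (∏ i, K i : ℝ≥0) * ∏ i, bergmanNorm (p i) (ω i) (f i) ^ q i := by
    rw [ENNReal.ofNNReal_finsetProd, ← Finset.prod_mul_distrib]
    exact Finset.prod_le_prod' fun i _ => hKle i (f i)
  rw [← ENNReal.mul_div_mul_left _ _ hK0 ENNReal.coe_ne_top]
  refine (ENNReal.div_le_div_left hnorm _).trans ?_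
  rw [mul_div_assoc]
  exact mul_le_mul_right (div_le_multiNorm hfv) _

theorem lpNorm_rpow_self (hq : 0 < q) (μ : Measure ℂ) (f : ℂ → ℂ) :
    lpNorm q μ f ^ q = ∫⁻ z in disc, ‖f z‖ₑ ^ q ∂μ := by
  rw [lpNorm_rpow hq, div_self hq.ne', ENNReal.rpow_one]

theorem isCarleson_iff_multiNorm_lt_top {a b : ℝ} (hv : IsNormalWeight v a b)
    (h : WeightEquiv ω v) (hp : 0 < p) (hq : 0 < q) (μ : Measure ℂ) :
    IsCarleson q p ω μ ↔
      multiNorm (fun _ : Fin 1 => p) (fun _ => q) (fun _ => ω) μ < ∞ := by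
  constructor
  · rintro ⟨C, hC⟩
    refine (multiNorm_le (M := (C : ℝ≥0∞) ^ q) fun f hf => ?_).trans_lt
      (ENNReal.rpow_lt_top_of_nonneg hq.le ENNReal.coe_ne_top)
    simp_rw [Fin.prod_univ_one]
    rw [← lpNorm_rpow_self hq, ← ENNReal.mul_rpow_of_nonneg _ _ hq.le]
    exact ENNReal.rpow_le_rpow (hC _ (hf 0)) hq.le
  · intro hM
    set M := multiNorm (fun _ : Fin 1 => p) (fun _ => q) (fun _ => v) μ
    have hMv : M < ∞ := (multiNorm_dominated_of_weightEquiv (fun _ => h.symm) (fun _ => hp)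
      fun _ => hq.le).lt_top hM
    obtain ⟨K, -, hK⟩ := h.symm.exists_bergmanNorm_rpow_le hp hq.le
    have hC : (M * K) ^ q⁻¹ ≠ ∞ := ENNReal.rpow_ne_top_of_nonneg (by positivity)
      (ENNReal.mul_ne_top hMv.ne ENNReal.coe_ne_top)
    refine ⟨((M * K) ^ q⁻¹).toNNReal, fun f hf => ?_⟩
    rw [ENNReal.coe_toNNReal hC, ← ENNReal.rpow_le_rpow_iff hq,
      ENNReal.mul_rpow_of_nonneg _ _ hq.le, ENNReal.rpow_inv_rpow hq.ne', lpNorm_rpow_self hq]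
    have hle := lintegral_prod_le_multiNorm_mul (μ := μ) (fun _ : Fin 1 => hv) (fun _ => hp)
      (fun _ => hq) fun _ => h.symm.bergmanSpace_subset hp hf
    simp only [Fin.prod_univ_one] at hle
    calc _ ≤ M * bergmanNorm p v f ^ q := hle
      _ ≤ M * (K * bergmanNorm p ω f ^ q) := mul_le_mul_right (hK f) _
      _ = _ := (mul_assoc _ _ _).symm

theorem idNorm_one_eq_multiNorm (p : ℝ) (ω : ℝ → ℝ) (μ : Measure ℂ) :
    idNorm p ω 1 μ = multiNorm (fun _ : Fin 1 => p) (fun _ => 1) (fun _ => ω) μ := by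
  have hlp (f : ℂ → ℂ) : lpNorm 1 μ f = ∫⁻ z in disc, ‖f z‖ₑ ^ (1 : ℝ) ∂μ := by
    rw [← lpNorm_rpow_self one_pos, ENNReal.rpow_one]
  simp_rw [idNorm, multiNorm, Fin.prod_univ_one, Fin.forall_fin_one, hlp, ENNReal.rpow_one]
  exact ((Equiv.funUnique (Fin 1) (ℂ → ℂ)).iSup_comp
    (g := fun f => ⨆ _ : f ∈ bergmanSpace p ω, (∫⁻ z in disc, ‖f z‖ₑ ∂μ) / bergmanNorm p ω f)).symm

end WeightComparison

section Reduction

variable {n m : ℕ} {p q a b : Fin n → ℝ} {v ω : Fin n → ℝ → ℝ}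
  {p' q' a' b' : Fin m → ℝ} {v' ω' : Fin m → ℝ → ℝ}

theorem totalExponent_pos (hn : 1 ≤ n) (hp : ∀ i, 0 < p i) (hq : ∀ i, 0 < q i) :
    0 < totalExponent p q :=
  Finset.sum_pos (fun i _ => div_pos (hq i) (hp i)) ⟨⟨0, hn⟩, Finset.mem_univ _⟩

theorem multiNorm_dominated_of_jointCellWeight_eq
    (hv : ∀ i, IsNormalWeight (v i) (a i) (b i)) (hp : ∀ i, 0 < p i) (hq : ∀ i, 0 < q i)
    (hv' : ∀ i, IsNormalWeight (v' i) (a' i) (b' i)) (hp' : ∀ i, 0 < p' i) (hq' : ∀ i, 0 < q' i)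
    (hl : 0 < totalExponent p q) (hexp : totalExponent p q = totalExponent p' q')
    (hW : EqOn (jointCellWeight p q v) (jointCellWeight p' q' v') disc) :
    Dominated (multiNorm p q v) (multiNorm p' q' v') := by
  obtain ⟨u, hu⟩ := exists_isLattice
  obtain ⟨C, hC⟩ := hu.exists_isLatticeCarleson hv' hp' hq'
  obtain ⟨D, hD⟩ := IsLatticeCarleson.exists_multiNorm_le hu hv hp (fun i => (hq i).le) hl
  have hcarleson (μ : Measure ℂ) : IsLatticeCarleson u (totalExponent p q) (jointCellWeight p q v)
      μ (C * multiNorm p' q' v' μ) := by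
    intro s hs y hy
    rw [hexp, Finset.sum_congr rfl fun c hc => by rw [hW (hu.subset_disc (hs hc))]]
    exact hC μ s hs y hy
  refine ⟨D * C, fun μ => (hD μ _ (hcarleson μ)).trans_eq ?_⟩
  rw [ENNReal.coe_mul, mul_assoc]

theorem isNormalWeight_productWeight (hv : ∀ i, IsNormalWeight (v i) (a i) (b i))
    (hpq : ∀ i, 0 ≤ q i / p i) (hl : 0 < totalExponent p q) :
    IsNormalWeight (productWeight p q v) (∑ i, q i / (totalExponent p q * p i) * a i)
      (∑ i, q i / (totalExponent p q * p i) * b i) := by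
  refine IsNormalWeight.prod_rpow hv (fun i => ?_) ?_
  · rw [mul_comm, ← div_div]
    exact div_nonneg (hpq i) hl.le
  · simp_rw [mul_comm (totalExponent p q), ← div_div]
    rw [← Finset.sum_div]
    exact div_self hl.ne'

theorem WeightEquiv.productWeight (h : ∀ i, WeightEquiv (ω i) (v i))
    (hω : ∀ i, ∀ r ∈ Ico (0 : ℝ) 1, 0 < ω i r) (hv : ∀ i, ∀ r ∈ Ico (0 : ℝ) 1, 0 < v i r)
    (hpq : ∀ i, 0 ≤ q i / p i) :
    WeightEquiv (productWeight p q ω) (productWeight p q v) := by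
  refine WeightEquiv.prod_rpow h (fun i r hr => (hω i r hr).le) (fun i r hr => (hv i r hr).le)
    fun i => ?_
  rw [mul_comm, ← div_div]
  exact div_nonneg (hpq i) (Finset.sum_nonneg fun i _ => hpq i)

theorem jointCellWeight_eq_cellWeight_productWeight_rpow
    (hv : ∀ i, ∀ r ∈ Ico (0 : ℝ) 1, 0 < v i r) (hl : totalExponent p q ≠ 0) {c : ℂ}
    (hc : c ∈ disc) :
    jointCellWeight p q v c = cellWeight (productWeight p q v) c ^ totalExponent p q := by
  have hc1 : 0 < 1 - ‖c‖ := sub_pos.2 (mem_disc.1 hc)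
  have hvc (i : Fin n) : 0 < v i ‖c‖ := hv i _ (norm_mem_Ico hc)
  have hprod : productWeight p q v ‖c‖ ^ totalExponent p q = ∏ i, v i ‖c‖ ^ (q i / p i) := by
    rw [productWeight, ← Real.finsetProd_rpow _ _ fun i _ => Real.rpow_nonneg (hvc i).le _]
    refine Finset.prod_congr rfl fun i _ => ?_
    rw [← Real.rpow_mul (hvc i).le, mul_comm (totalExponent p q), ← div_div, div_mul_cancel₀ _ hl]
  have hpos : 0 < productWeight p q v ‖c‖ :=
    Finset.prod_pos fun i _ => Real.rpow_pos_of_pos (hvc i) _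
  have hcell (i : Fin n) : 0 < (1 - ‖c‖) ^ 2 * v i ‖c‖ := mul_pos (by positivity) (hvc i)
  calc _ = ENNReal.ofReal (∏ i, ((1 - ‖c‖) ^ 2 * v i ‖c‖) ^ (q i / p i)) := by
        rw [ENNReal.ofReal_prod_of_nonneg fun i _ => Real.rpow_nonneg (hcell i).le _]
        exact Finset.prod_congr rfl fun i _ => ENNReal.ofReal_rpow_of_pos (hcell i)
    _ = ENNReal.ofReal (((1 - ‖c‖) ^ 2 * productWeight p q v ‖c‖) ^ totalExponent p q) := by
        simp_rw [Real.mul_rpow (by positivity : 0 ≤ (1 - ‖c‖) ^ 2) (hvc _).le,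
          Finset.prod_mul_distrib]
        rw [Real.mul_rpow (by positivity) hpos.le, hprod, totalExponent,
          Real.rpow_sum_of_pos (by positivity)]
    _ = _ := by rw [cellWeight, ENNReal.ofReal_rpow_of_pos (by positivity)]

theorem multiNorm_dominated_of_isRegularWeight (hn : 1 ≤ n) (hp : ∀ i, 0 < p i)
    (hq : ∀ i, 0 < q i) (hω : ∀ i, IsRegularWeight (ω i)) {P Q : ℝ} (hP : 0 < P) (hQ : 0 < Q)
    (hPQ : Q / P = totalExponent p q) :
    Dominated (multiNorm p q ω)
        (multiNorm (fun _ : Fin 1 => P) (fun _ => Q) fun _ => productWeight p q ω) ∧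
      Dominated (multiNorm (fun _ : Fin 1 => P) (fun _ => Q) fun _ => productWeight p q ω)
        (multiNorm p q ω) := by
  choose v a b hv hωv using fun i => (hω i).exists_isNormalWeight
  have hpq (i : Fin n) : 0 ≤ q i / p i := (div_pos (hq i) (hp i)).le
  have hl := totalExponent_pos hn hp hq
  have hV := isNormalWeight_productWeight hv hpq hl
  have hωV := WeightEquiv.productWeight hωv (fun i => (hω i).pos) (fun i => (hv i).pos) hpq
  have hexp : totalExponent (fun _ : Fin 1 => P) (fun _ => Q) = totalExponent p q := by
    rw [← hPQ, totalExponent, Fin.sum_univ_one]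
  have hW : EqOn (jointCellWeight p q v)
      (jointCellWeight (fun _ : Fin 1 => P) (fun _ => Q) fun _ => productWeight p q v) disc := by
    intro c hc
    rw [jointCellWeight_eq_cellWeight_productWeight_rpow (fun i => (hv i).pos) hl.ne' hc, ← hPQ,
      jointCellWeight, Fin.prod_univ_one]
  have hq' (i : Fin n) : 0 ≤ q i := (hq i).le
  constructor
  · exact (multiNorm_dominated_of_weightEquiv hωv hp hq').trans <|
      (multiNorm_dominated_of_jointCellWeight_eq hv hp hq (fun _ => hV) (fun _ => hP) (fun _ => hQ)
        hl hexp.symm hW).trans <|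
      multiNorm_dominated_of_weightEquiv (fun _ => hωV.symm) (fun _ => hP) fun _ => hQ.le
  · exact (multiNorm_dominated_of_weightEquiv (fun _ => hωV) (fun _ => hP) fun _ => hQ.le).trans <|
      (multiNorm_dominated_of_jointCellWeight_eq (fun _ => hV) (fun _ => hP) (fun _ => hQ) hv hp hq
        (hexp ▸ hl) hexp hW.symm).trans <|
      multiNorm_dominated_of_weightEquiv (fun i => (hωv i).symm) hp hq'

theorem isCarleson_productWeight_iff_multiNorm_lt_top (hp : ∀ i, 0 < p i)
    (hq : ∀ i, 0 < q i) (hω : ∀ i, IsRegularWeight (ω i)) (hl : 0 < totalExponent p q)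
    {P Q : ℝ} (hP : 0 < P) (hQ : 0 < Q) (μ : Measure ℂ) :
    IsCarleson Q P (productWeight p q ω) μ ↔
      multiNorm (fun _ : Fin 1 => P) (fun _ => Q) (fun _ => productWeight p q ω) μ < ∞ := by
  choose v a b hv hωv using fun i => (hω i).exists_isNormalWeight
  have hpq (i : Fin n) : 0 ≤ q i / p i := (div_pos (hq i) (hp i)).le
  exact isCarleson_iff_multiNorm_lt_top (isNormalWeight_productWeight hv hpq hl)
    (WeightEquiv.productWeight hωv (fun i => (hω i).pos) (fun i => (hv i).pos) hpq) hP hQ μ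

end Reduction

end WeightedBergman

end

open WeightedBergman

theorem theorem2 {n : ℕ} (hn : 1 ≤ n) (p q : Fin n → ℝ) (hp : ∀ i, 0 < p i) (hq : ∀ i, 0 < q i)
    (ω : Fin n → ℝ → ℝ) (hω : ∀ i, WeightedBergman.IsRegularWeight (ω i)) :
    (∀ μ : MeasureTheory.Measure ℂ,
      WeightedBergman.IsCarleson (WeightedBergman.totalExponent p q) 1
          (WeightedBergman.productWeight p q ω) μ ↔
        WeightedBergman.multiNorm p q ω μ < ⊤) ∧
    ∃ C : NNReal, 0 < C ∧ ∀ μ : MeasureTheory.Measure ℂ,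
      WeightedBergman.multiNorm p q ω μ ≤
          C * WeightedBergman.idNorm (1 / WeightedBergman.totalExponent p q)
            (WeightedBergman.productWeight p q ω) 1 μ ∧
        WeightedBergman.idNorm (1 / WeightedBergman.totalExponent p q)
            (WeightedBergman.productWeight p q ω) 1 μ ≤
          C * WeightedBergman.multiNorm p q ω μ := by
  have hl := totalExponent_pos hn hp hq
  constructor
  · obtain ⟨hle, hge⟩ :=
      multiNorm_dominated_of_isRegularWeight hn hp hq hω one_pos hl (div_one _)
    intro μ
    rw [isCarleson_productWeight_iff_multiNorm_lt_top hp hq hω hl one_pos hl]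
    exact ⟨hle.lt_top, hge.lt_top⟩
  · obtain ⟨hle, hge⟩ :=
      multiNorm_dominated_of_isRegularWeight hn hp hq hω (one_div_pos.2 hl) one_pos
        (one_div_one_div _)
    simp_rw [idNorm_one_eq_multiNorm]
    exact hle.exists_pos_forall_le hge
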